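/- Let $0<\alpha<1$ and let $p_\alpha(t,x)$, $t,x>0$, be the positive $\alpha$-stable kernel: for every $t>0$, $p_\alpha(t,\cdot)$ is the (unique, existing) continuous nonnegative function on $(0,\infty)$ with Laplace transform $$\int_0^\infty p_\alpha(t,x)\,e^{-\lambda x}\,dx = e^{-t\lambda^\alpha},\qquad \lambda>0.$$ A kernel $K:(0,\infty)\times(0,\infty)\to\mathbb{R}$ is called totally positive of order $n$ ($\mathrm{TP}_n$) if $\det[K(x_i,y_j)]_{1\le i,j\le m}\ge 0$ for every $m\in\{1,\dots,n\}$, all $0<x_1<\dots<x_m$ and all $0<y_1<\dots<y_m$. Then, for every $n\ge 2$, the kernel $(t,x)\mapsto p_\alpha(t,x)$ is $\mathrm{TP}_n$ if and only if $\alpha\in\{1/2,1/3,\dots,1/n\}$ or $\alpha<1/n$. -/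

import Mathlib

open MeasureTheory Set

/-- The kernel `K` is totally positive of order `n` on `I × I`: all minors of size `m ∈ {1, …, n}`
taken at increasing points of `I` are nonnegative. -/
def IsTotallyPositive (n : ℕ) (I : Set ℝ) (K : ℝ → ℝ → ℝ) : Prop :=
  ∀ m : ℕ, 1 ≤ m → m ≤ n → ∀ x y : Fin m → ℝ,
    StrictMono x → StrictMono y → (∀ i, x i ∈ I) → (∀ j, y j ∈ I) →
      0 ≤ (Matrix.of fun i j => K (x i) (y j)).det

/-- `p` is the positive `α`-stable kernel `(t, x) ↦ p t x`, `t, x > 0`: for every time `t > 0`,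
`p t` is the continuous (nonnegative) density on `(0, ∞)` whose Laplace transform is
`l ↦ exp (-t l ^ α)`. Total mass one follows on letting `l → 0`, and the values `p t x` for
`t, x > 0` are determined by these conditions. -/
structure IsPositiveStableKernel (α : ℝ) (p : ℝ → ℝ → ℝ) : Prop where
  continuousOn : ∀ t, 0 < t → ContinuousOn (p t) (Ioi 0)
  nonneg : ∀ t, 0 < t → ∀ x, 0 < x → 0 ≤ p t x
  integrableOn : ∀ t, 0 < t → ∀ l : ℝ, 0 < l →
    IntegrableOn (fun x => p t x * Real.exp (-(l * x))) (Ioi 0)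
  laplace : ∀ t, 0 < t → ∀ l : ℝ, 0 < l →
    ∫ x in Ioi (0 : ℝ), p t x * Real.exp (-(l * x)) = Real.exp (-(t * l ^ α))

/-! ### Determinants of integrals and composition of kernels -/

/-! Let `M_k(t, l) = (-d/dl)^k exp (-t l ^ α)` be the `k`-th moment of `p t x * exp (-(l * x))` in
`x`. The Post–Widder formula recovers `p t x`, up to positive factors depending only on `x` and `k`,
as the limit of `M_k` at `l = (k + 1) / x`. Total positivity of `p` thus follows from nonnegative
minors of every `M_k`, for `t` increasing and `l` decreasing.

Sufficiency: a Gamma integral shows that `M_1` is `t` times a constant times the fractional integral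
of `M_0` in the time variable, with kernel `(s - t)₊ ^ (1/α - 2)`; differentiating in `l` gives the
same relation from `M_k` to `M_(k+1)` (`stableMoment_succ`). The minors of `M_0` are those of an
exponential kernel, and composition preserves nonnegativity (`det_integral_mul_nonneg`). Everything
reduces to the truncated powers, whose minors of size `m` are nonnegative when the exponent is a
natural number or at least `m - 2` (`det_truncPow_nonneg`). With exponent `1/α - 2` this means `1/α`
an integer, `1/α ≥ 2`, or `m ≤ 1/α`.

Necessity: composing a totally positive `p` with `x ^ 2 * exp (-(l * x))` makes the minors of `M_2`
nonnegative. Up to row and column factors, `M_2` is `exp (-w) * ((1 - α) + α w)` with `w = t l ^ α`.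
As `w → 0` the sign of a minor is read off Taylor coefficients
(`prod_coeff_mul_vandermonde_nonneg`). Compared with `exp (-w)`, the `j`-th coefficient acquires the
factor `1 - (j + 1) α`; if `k α < 1 < (k + 1) α`, exactly one of the first `k + 1` factors is
negative, a contradiction.

Existence comes from the complex inversion integral of `exp (-z ^ α)` on a vertical line; positivity
comes from Post–Widder again. -/

theorem integrable_det {m : ℕ} {E : Type*} [MeasurableSpace E] (μ : Fin m → Measure E)
    [∀ j, SigmaFinite (μ j)] (q : Fin m → Fin m → E → ℝ) (h : ∀ i j, Integrable (q i j) (μ j)) :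
    Integrable (fun s : Fin m → E => (Matrix.of fun i j => q i j (s j)).det) (Measure.pi μ) := by
  simp only [Matrix.det_apply', Matrix.of_apply]
  refine integrable_finsetSum _ fun σ _ => Integrable.const_mul ?_ _
  exact Integrable.fintype_prod (f := fun j => q (σ j) j) fun j => h _ _

/-- Each term of the Leibniz formula uses one entry per column, so giving each column its own
variable turns products of integrals into integrals over the product measure. -/
theorem det_integral {m : ℕ} {E : Type*} [MeasurableSpace E] (μ : Fin m → Measure E)
    [∀ j, SigmaFinite (μ j)] (q : Fin m → Fin m → E → ℝ) (h : ∀ i j, Integrable (q i j) (μ j)) :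
    (Matrix.of fun i j => ∫ s, q i j s ∂μ j).det =
      ∫ s, (Matrix.of fun i j => q i j (s j)).det ∂Measure.pi μ := by
  simp only [Matrix.det_apply', Matrix.of_apply]
  rw [integral_finsetSum]
  · refine Finset.sum_congr rfl fun σ _ => ?_
    rw [integral_const_mul, integral_fintype_prod_eq_prod (fun j => q (σ j) j)]
  · intro σ _
    refine Integrable.const_mul ?_ _
    exact Integrable.fintype_prod (f := fun j => q (σ j) j) fun j => h _ _

theorem measurePreserving_comp_perm {m : ℕ} (μ : Measure ℝ) [SigmaFinite μ]
    (σ : Equiv.Perm (Fin m)) :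
    MeasurePreserving (fun s : Fin m → ℝ => s ∘ σ) (Measure.pi fun _ => μ)
      (Measure.pi fun _ => μ) ∧ MeasurableEmbedding (fun s : Fin m → ℝ => s ∘ σ) := by
  have e : (fun s : Fin m → ℝ => s ∘ σ) = MeasurableEquiv.piCongrLeft (fun _ => ℝ) σ.symm := by
    funext s i
    obtain ⟨a, rfl⟩ := σ.symm.surjective i
    simp [MeasurableEquiv.coe_piCongrLeft, Equiv.piCongrLeft_apply_apply]
  rw [e]
  exact ⟨measurePreserving_piCongrLeft (fun _ => μ) σ.symm, MeasurableEquiv.measurableEmbedding _⟩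

/-- Sorting `s` multiplies both determinants by the same sign, which cancels in the product;
repeated points make a column repeat. -/
theorem det_mul_det_nonneg_of_strictMono {m : ℕ} {I : Set ℝ} {K : Fin m → ℝ → ℝ}
    {L : ℝ → Fin m → ℝ}
    (hK : ∀ s : Fin m → ℝ, StrictMono s → (∀ i, s i ∈ I) →
      0 ≤ (Matrix.of fun i j => K i (s j)).det)
    (hL : ∀ s : Fin m → ℝ, StrictMono s → (∀ i, s i ∈ I) →
      0 ≤ (Matrix.of fun i j => L (s i) j).det)
    (s : Fin m → ℝ) (hs : ∀ i, s i ∈ I) :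
    0 ≤ (Matrix.of fun i j => K i (s j)).det * (Matrix.of fun i j => L (s i) j).det := by
  by_cases hinj : Function.Injective s
  · set σ := Tuple.sort s
    have hmono : StrictMono (s ∘ σ) :=
      (Tuple.monotone_sort s).strictMono_of_injective (hinj.comp σ.injective)
    have h1 := hK _ hmono fun i => hs _
    have h2 := hL _ hmono fun i => hs _
    have e1 := Matrix.det_permute' σ (Matrix.of fun i j => K i (s j))
    have e2 := Matrix.det_permute σ (Matrix.of fun i j => L (s i) j)
    have e1' : ((Matrix.of fun i j => K i (s j)).submatrix id σ) =
      Matrix.of fun i j => K i ((s ∘ σ) j) := rfl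
    have e2' : ((Matrix.of fun i j => L (s i) j).submatrix σ id) =
      Matrix.of fun i j => L ((s ∘ σ) i) j := rfl
    rw [e1'] at e1
    rw [e2'] at e2
    have h3 := mul_nonneg h1 h2
    rw [e1, e2] at h3
    have h4 : (((Equiv.Perm.sign σ : ℤˣ) : ℤ) : ℝ) * ((Equiv.Perm.sign σ : ℤˣ) : ℤ) = 1 := by
      rcases Int.units_eq_one_or (Equiv.Perm.sign σ) with h | h <;> simp [h]
    calc (0 : ℝ) ≤ _ := h3
      _ = ((((Equiv.Perm.sign σ : ℤˣ) : ℤ) : ℝ) * ((Equiv.Perm.sign σ : ℤˣ) : ℤ)) *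
        ((Matrix.of fun i j => K i (s j)).det * (Matrix.of fun i j => L (s i) j).det) := by ring
      _ = _ := by rw [h4, one_mul]
  · obtain ⟨a, b, hab, hne⟩ : ∃ a b, s a = s b ∧ a ≠ b := by
      simpa [Function.Injective] using hinj
    rw [Matrix.det_zero_of_column_eq (M := Matrix.of fun i j => K i (s j)) hne
      (fun i => by simp [hab]), zero_mul]

/-- Composition of kernels with nonnegative minors has nonnegative minors. -/
theorem det_integral_mul_nonneg {m : ℕ} (μ : Measure ℝ) [SigmaFinite μ] {I : Set ℝ}
    (hI : ∀ᵐ s ∂μ, s ∈ I) {K : Fin m → ℝ → ℝ} {L : ℝ → Fin m → ℝ}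
    (hinteg : ∀ i j, Integrable (fun s => K i s * L s j) μ)
    (hK : ∀ s : Fin m → ℝ, StrictMono s → (∀ i, s i ∈ I) →
      0 ≤ (Matrix.of fun i j => K i (s j)).det)
    (hL : ∀ s : Fin m → ℝ, StrictMono s → (∀ i, s i ∈ I) →
      0 ≤ (Matrix.of fun i j => L (s i) j).det) :
    0 ≤ (Matrix.of fun i j => ∫ s, K i s * L s j ∂μ).det := by
  rw [det_integral (fun _ => μ) (fun i j s => K i s * L s j) hinteg]
  have hFint := integrable_det (fun _ => μ) (fun i j s => K i s * L s j) hinteg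
  set F : (Fin m → ℝ) → ℝ := fun s => (Matrix.of fun i j => K i (s j) * L (s j) j).det with hF
  have hF' : ∀ s, F s = (∏ j, L (s j) j) * (Matrix.of fun i j => K i (s j)).det := by
    intro s
    rw [← Matrix.det_mul_row]
    simp only [hF, Matrix.of_apply, mul_comm]
  -- Andréief's identity: symmetrizing the integrand over permutations of the variables produces the
  -- product of the two determinants, at the price of a factor `m!`.
  have hsum : ∀ s, ∑ σ : Equiv.Perm (Fin m), F (s ∘ σ) =
      (Matrix.of fun i j => K i (s j)).det * (Matrix.of fun i j => L (s i) j).det := by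
    intro s
    rw [Matrix.det_apply' (Matrix.of fun i j => L (s i) j), Finset.mul_sum]
    refine Finset.sum_congr rfl fun σ _ => ?_
    rw [hF']
    have e1 := Matrix.det_permute' σ (Matrix.of fun i j => K i (s j))
    have e1' : ((Matrix.of fun i j => K i (s j)).submatrix id σ) =
      Matrix.of fun i j => K i ((s ∘ σ) j) := rfl
    rw [e1'] at e1
    rw [e1]
    simp only [Matrix.of_apply, Function.comp]
    ring
  have hcomp : ∀ σ : Equiv.Perm (Fin m), ∫ s, F (s ∘ σ) ∂(Measure.pi fun _ => μ) =
      ∫ s, F s ∂(Measure.pi fun _ => μ) := fun σ =>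
    (measurePreserving_comp_perm μ σ).1.integral_comp (measurePreserving_comp_perm μ σ).2 F
  have hcard : (Fintype.card (Equiv.Perm (Fin m)) : ℝ) * ∫ s, F s ∂(Measure.pi fun _ => μ) =
      ∫ s, ∑ σ : Equiv.Perm (Fin m), F (s ∘ σ) ∂(Measure.pi fun _ => μ) := by
    rw [integral_finsetSum]
    · simp [hcomp]
    · intro σ _
      exact ((measurePreserving_comp_perm μ σ).1.integrable_comp_emb
        (measurePreserving_comp_perm μ σ).2).2 hFint
  have hnn : 0 ≤ (Fintype.card (Equiv.Perm (Fin m)) : ℝ) *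
      ∫ s, F s ∂(Measure.pi fun _ => μ) := by
    rw [hcard]
    refine integral_nonneg_of_ae ?_
    have hall : ∀ᵐ s ∂(Measure.pi fun _ : Fin m => μ), ∀ i, s i ∈ I :=
      ae_all_iff.2 fun i => (Measure.quasiMeasurePreserving_eval (fun _ => μ) i).ae hI
    filter_upwards [hall] with s hs
    rw [hsum]
    exact det_mul_det_nonneg_of_strictMono hK hL s hs
  exact nonneg_of_mul_nonneg_right hnn (by exact_mod_cast Fintype.card_pos)

/-! ### Truncated powers -/

/-- The truncated power `z₊ ^ a`, with value `0` for `z ≤ 0` also when `a ≤ 0`. -/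
noncomputable def truncPow (a z : ℝ) : ℝ := if 0 < z then z ^ a else 0

theorem truncPow_of_pos {a z : ℝ} (h : 0 < z) : truncPow a z = z ^ a := if_pos h

theorem truncPow_of_nonpos {a z : ℝ} (h : z ≤ 0) : truncPow a z = 0 := if_neg h.not_gt

theorem truncPow_nonneg (a z : ℝ) : 0 ≤ truncPow a z := by
  unfold truncPow; split_ifs with h
  · exact Real.rpow_nonneg h.le _
  · exact le_rfl

theorem truncPow_mul {a c z : ℝ} (hc : 0 < c) : truncPow a (c * z) = c ^ a * truncPow a z := by
  rcases lt_or_ge 0 z with h | h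
  · rw [truncPow_of_pos h, truncPow_of_pos (mul_pos hc h), Real.mul_rpow hc.le h.le]
  · rw [truncPow_of_nonpos h, truncPow_of_nonpos (mul_nonpos_of_nonneg_of_nonpos hc.le h), mul_zero]

theorem measurable_truncPow (a : ℝ) : Measurable (truncPow a) :=
  Measurable.ite measurableSet_Ioi (by fun_prop) measurable_const

theorem intervalIntegrable_truncPow {a : ℝ} (ha : 0 < a) (u v : ℝ) :
    IntervalIntegrable (truncPow (a - 1)) volume u v := by
  have h : IntervalIntegrable (fun x : ℝ => x ^ (a - 1)) volume u v :=
    intervalIntegral.intervalIntegrable_rpow' (by linarith)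
  refine ⟨?_, ?_⟩
  · exact (h.1.indicator (measurableSet_Ioi (a := 0))).congr
      (Filter.Eventually.of_forall fun x => by simp [truncPow, indicator])
  · exact (h.2.indicator (measurableSet_Ioi (a := 0))).congr
      (Filter.Eventually.of_forall fun x => by simp [truncPow, indicator])

theorem integral_zero_truncPow {a : ℝ} (ha : 0 < a) (v : ℝ) :
    truncPow a v = a * ∫ s in (0 : ℝ)..v, truncPow (a - 1) s := by
  rcases le_or_gt v 0 with hv | hv
  · rw [truncPow_of_nonpos hv, intervalIntegral.integral_symm,
      intervalIntegral.integral_of_le hv,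
      setIntegral_congr_fun (g := fun _ => 0) measurableSet_Ioc fun s hs => truncPow_of_nonpos hs.2]
    simp
  · rw [truncPow_of_pos hv, intervalIntegral.integral_of_le hv.le,
      setIntegral_congr_fun (g := fun s => s ^ (a - 1)) measurableSet_Ioc
        fun s hs => truncPow_of_pos hs.1, ← intervalIntegral.integral_of_le hv.le,
      integral_rpow (Or.inl (by linarith)), sub_add_cancel, Real.zero_rpow ha.ne', sub_zero]
    field_simp

theorem truncPow_sub {a : ℝ} (ha : 0 < a) (u v : ℝ) :
    truncPow a v - truncPow a u = a * ∫ s in u..v, truncPow (a - 1) s := by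
  rw [integral_zero_truncPow ha v, integral_zero_truncPow ha u, ← mul_sub,
    intervalIntegral.integral_interval_sub_left (intervalIntegrable_truncPow ha _ _)
      (intervalIntegrable_truncPow ha _ _)]

/-- Column `j` is integrated over its own interval and these intervals are consecutive, so the
sample points are automatically increasing. -/
theorem det_intervalIntegral_nonneg {m : ℕ} {v : Fin (m + 1) → ℝ} (hv : StrictMono v)
    {q : Fin m → ℝ → ℝ} (hq : ∀ i u w, IntervalIntegrable (q i) volume u w)
    (hdet : ∀ s : Fin m → ℝ, StrictMono s → 0 ≤ (Matrix.of fun i j => q i (s j)).det) :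
    0 ≤ (Matrix.of fun i (j : Fin m) => ∫ s in v j.castSucc..v j.succ, q i s).det := by
  have hle : ∀ j : Fin m, v j.castSucc ≤ v j.succ := fun j => (hv j.castSucc_lt_succ).le
  have hA : (Matrix.of fun i (j : Fin m) => ∫ s in v j.castSucc..v j.succ, q i s) =
      Matrix.of fun i (j : Fin m) => ∫ s in Ioc (v j.castSucc) (v j.succ), q i s := by
    ext i j
    exact intervalIntegral.integral_of_le (hle j)
  rw [hA, det_integral (fun j : Fin m => volume.restrict (Ioc (v j.castSucc) (v j.succ)))
    (fun i _ => q i) fun i j => (hq i _ _).1, ← Measure.restrict_pi_pi]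
  refine setIntegral_nonneg (MeasurableSet.univ_pi fun _ => measurableSet_Ioc) fun s hs => ?_
  refine hdet s fun i j hij => ?_
  have h1 := (hs i (mem_univ i)).2
  have h2 := (hs j (mem_univ j)).1
  exact (h1.trans (hv.monotone (Fin.succ_le_castSucc_iff.2 hij))).trans_lt h2

/-- The entries are `0` or `1`. Unless column 0 vanishes, row 0 consists of ones; then either
another row equals it, or column 0 has a single nonzero entry and expansion lowers the size. -/
theorem det_truncPow_zero_nonneg : ∀ (m : ℕ) (x y : Fin m → ℝ), StrictMono x → StrictMono y →
    0 ≤ (Matrix.of fun i j => truncPow 0 (y j - x i)).det := by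
  intro m
  induction m with
  | zero => intro x y _ _; simp
  | succ m ih =>
    intro x y hx hy
    rcases le_or_gt (y 0) (x 0) with h0 | h0
    · refine le_of_eq (Matrix.det_eq_zero_of_column_eq_zero 0 fun i => ?_).symm
      exact truncPow_of_nonpos (by have := hx.monotone (Fin.zero_le i); linarith)
    have hrow : ∀ j, truncPow 0 (y j - x 0) = 1 := fun j => by
      rw [truncPow_of_pos (by have := hy.monotone (Fin.zero_le j); linarith), Real.rpow_zero]
    by_cases h1 : ∃ i, i ≠ 0 ∧ x i < y 0
    · obtain ⟨i, hi, hlt⟩ := h1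
      refine le_of_eq (Matrix.det_zero_of_row_eq hi (funext fun j => ?_)).symm
      simp only [Matrix.of_apply]
      rw [hrow, truncPow_of_pos (by have := hy.monotone (Fin.zero_le j); linarith), Real.rpow_zero]
    · push Not at h1
      have hcol : ∀ i : Fin m, truncPow 0 (y 0 - x i.succ) = 0 := fun i =>
        truncPow_of_nonpos (by have := h1 i.succ (Fin.succ_ne_zero i); linarith)
      rw [Matrix.det_succ_column_zero, Fin.sum_univ_succ]
      simp only [Matrix.of_apply, hcol, hrow]
      have := ih (x ∘ Fin.succ) (y ∘ Fin.succ) (hx.comp Fin.strictMono_succ)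
        (hy.comp Fin.strictMono_succ)
      simpa [Matrix.submatrix, Function.comp_def] using this

/-- Dividing by the first row and taking differences of consecutive columns. -/
theorem det_eq_det_col_diff {m : ℕ} (B : Matrix (Fin (m + 1)) (Fin (m + 1)) ℝ)
    (h0 : ∀ j, B 0 j = 1) :
    B.det = (Matrix.of fun i j : Fin m => B i.succ j.succ - B i.succ j.castSucc).det := by
  rw [Matrix.det_eq_of_forall_col_eq_smul_add_pred (A := B)
    (B := Matrix.of fun i => Fin.cases (B i 0) fun j => B i j.succ - B i j.castSucc)
    (fun _ => 1) (fun i => rfl) (fun i j => by simp), Matrix.det_succ_row_zero,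
    Fin.sum_univ_succ]
  simp [h0]
  rfl

/-- Induction lowering size and exponent together, which preserves the condition on `a`. A
projective change of variable turns row 0 into ones while keeping the truncated power form; column
differences are then integrals of truncated powers of exponent `a - 1`. -/
theorem det_truncPow_nonneg : ∀ (m : ℕ) (a : ℝ), ((∃ k : ℕ, a = k) ∨ (m : ℝ) - 2 ≤ a) →
    ∀ x y : Fin m → ℝ, StrictMono x → StrictMono y →
      0 ≤ (Matrix.of fun i j => truncPow a (y j - x i)).det := by
  intro m
  induction m with
  | zero => intro a _ x y _ _; simp
  | succ m ih =>
    intro a ha x y hx hy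
    rcases Nat.eq_zero_or_pos m with rfl | hm
    · simpa using truncPow_nonneg a (y 0 - x 0)
    have hm1 : (1 : ℝ) ≤ m := by exact_mod_cast hm
    have ha0 : 0 ≤ a := by
      rcases ha with ⟨k, rfl⟩ | ha
      · positivity
      · push_cast at ha; linarith
    rcases ha0.eq_or_lt with rfl | hapos
    · exact det_truncPow_zero_nonneg _ x y hx hy
    have ha' : (∃ k : ℕ, a - 1 = k) ∨ (m : ℝ) - 2 ≤ a - 1 := by
      rcases ha with ⟨k, rfl⟩ | ha
      · left
        have : 0 < k := by exact_mod_cast hapos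
        exact ⟨k - 1, by push_cast [Nat.cast_sub (Nat.succ_le_of_lt this)]; ring⟩
      · right; push_cast at ha; linarith
    rcases le_or_gt (y 0) (x 0) with h0 | h0
    · refine le_of_eq (Matrix.det_eq_zero_of_column_eq_zero 0 fun i => ?_).symm
      exact truncPow_of_nonpos (by have := hx.monotone (Fin.zero_le i); linarith)
    have hr : ∀ j, 0 < y j - x 0 := fun j => by
      have := hy.monotone (Fin.zero_le j); linarith
    have hd : ∀ i : Fin m, 0 < x i.succ - x 0 := fun i => by
      have := hx (Fin.succ_pos i); linarith
    -- The increasing map `z ↦ -1 / (z - x 0)` is applied to all points: `(y j - x i) / (y j - x 0)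
    -- = 1 + (x i - x 0) * v j`, which for later rows equals `(x i - x 0)` times the difference of
    -- the images of `y j` and `x i`.
    set v : Fin (m + 1) → ℝ := fun j => -(y j - x 0)⁻¹ with hv
    have hvm : StrictMono v := fun i j hij => by
      have := inv_strictAnti₀ (hr i) (show y i - x 0 < y j - x 0 by linarith [hy hij])
      simp only [hv]; linarith
    set ξ : Fin m → ℝ := fun i => -(x i.succ - x 0)⁻¹ with hξ
    have hξm : StrictMono ξ := fun i j hij => by
      have := inv_strictAnti₀ (hd i) (show x i.succ - x 0 < x j.succ - x 0 by
        linarith [hx (Fin.succ_lt_succ_iff.2 hij)])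
      simp only [hξ]; linarith
    have hA : (Matrix.of fun i j => truncPow a (y j - x i)) =
        Matrix.of fun i j => (y j - x 0) ^ a *
          (Matrix.of fun i j => truncPow a (1 + (x i - x 0) * v j)) i j := by
      ext i j
      simp only [Matrix.of_apply]
      rw [← truncPow_mul (hr j)]
      congr 1
      have := (hr j).ne'
      simp only [hv]
      field_simp
      ring
    rw [hA, Matrix.det_mul_row]
    refine mul_nonneg (Finset.prod_nonneg fun j _ => Real.rpow_nonneg (hr j).le _) ?_
    rw [det_eq_det_col_diff _ (fun j => by simp [truncPow_of_pos])]
    have hB : (Matrix.of fun i j : Fin m =>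
        (Matrix.of fun i j => truncPow a (1 + (x i - x 0) * v j)) i.succ j.succ -
        (Matrix.of fun i j => truncPow a (1 + (x i - x 0) * v j)) i.succ j.castSucc) =
        Matrix.of fun i j => ((x i.succ - x 0) ^ a * a) *
          (Matrix.of fun i (j : Fin m) =>
            ∫ s in v j.castSucc..v j.succ, truncPow (a - 1) (s - ξ i)) i j := by
      ext i j
      have e : ∀ w, truncPow a (1 + (x i.succ - x 0) * w) =
          (x i.succ - x 0) ^ a * truncPow a (w - ξ i) := fun w => by
        rw [← truncPow_mul (hd i)]
        congr 1
        have := (hd i).ne'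
        simp only [hξ]
        field_simp
        ring
      simp only [Matrix.of_apply]
      rw [e, e, ← mul_sub, truncPow_sub hapos,
        intervalIntegral.integral_comp_sub_right (fun s => truncPow (a - 1) s), mul_assoc]
    rw [hB, Matrix.det_mul_column]
    refine mul_nonneg (Finset.prod_nonneg fun i _ =>
      mul_nonneg (Real.rpow_nonneg (hd i).le _) ha0) ?_
    refine det_intervalIntegral_nonneg hvm (q := fun i s => truncPow (a - 1) (s - ξ i))
      (fun i u w => ?_) fun s hs => ih (a - 1) ha' ξ s hξm hs
    simpa using (intervalIntegrable_truncPow hapos (u - ξ i) (w - ξ i)).comp_sub_right (ξ i)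

/-! ### The exponential kernel -/

/-- Limit of `(1 - s μ / N)₊ ^ N = (μ / N) ^ N * (N / μ - s)₊ ^ N`; the exponent is a natural
number, so minors of every size are covered. -/
theorem det_exp_neg_mul_nonneg {m : ℕ} {s μ : Fin m → ℝ} (hs : StrictMono s) (hμ : StrictAnti μ)
    (hμ0 : ∀ j, 0 < μ j) : 0 ≤ (Matrix.of fun i j => Real.exp (-(s i * μ j))).det := by
  have hlim : Filter.Tendsto (fun N : ℕ =>
      (Matrix.of fun i j => truncPow N (1 + -(s i * μ j) / N)).det) Filter.atTop
      (nhds (Matrix.of fun i j => Real.exp (-(s i * μ j))).det) := by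
    refine ((continuous_id.matrix_det).tendsto _).comp ?_
    refine tendsto_pi_nhds.2 fun i => tendsto_pi_nhds.2 fun j => ?_
    refine (Real.tendsto_one_add_div_pow_exp (-(s i * μ j))).congr' ?_
    have h0 : Filter.Tendsto (fun N : ℕ => 1 + -(s i * μ j) / (N : ℝ)) Filter.atTop
        (nhds (1 + 0)) :=
      (tendsto_const_div_atTop_nhds_zero_nat _).const_add 1
    filter_upwards [h0.eventually (lt_mem_nhds (show (0 : ℝ) < 1 + 0 by norm_num))] with N hN
    simp only [Matrix.of_apply]
    rw [truncPow_of_pos hN, Real.rpow_natCast]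
  refine ge_of_tendsto hlim ?_
  filter_upwards [Filter.eventually_gt_atTop 0] with N hN
  have hN' : (0 : ℝ) < N := by exact_mod_cast hN
  have hA : (Matrix.of fun i j => truncPow N (1 + -(s i * μ j) / N)) =
      Matrix.of fun i j => (μ j / N) ^ (N : ℝ) *
        (Matrix.of fun i j => truncPow N (N / μ j - s i)) i j := by
    ext i j
    simp only [Matrix.of_apply]
    rw [← truncPow_mul (div_pos (hμ0 j) hN')]
    congr 1
    have := (hμ0 j).ne'
    field_simp
    ring
  rw [hA, Matrix.det_mul_row]
  refine mul_nonneg (Finset.prod_nonneg fun j _ =>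
    Real.rpow_nonneg (div_nonneg (hμ0 j).le hN'.le) _) ?_
  exact det_truncPow_nonneg m N (Or.inl ⟨N, rfl⟩) s (fun j => N / μ j) hs fun i j hij =>
    div_lt_div_of_pos_left hN' (hμ0 j) (hμ hij)

/-! ### Derivatives of `l ↦ exp (-t l ^ α)` -/

/-- The polynomials `P k` with `(-d/dl)^k exp (-t l ^ α) = l ^ (-k) exp (-w) (P k)(w)`, where
`w = t l ^ α`. -/
noncomputable def stablePoly (α : ℝ) : ℕ → Polynomial ℝ
  | 0 => 1
  | k + 1 => Polynomial.C (k : ℝ) * stablePoly α k +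
      Polynomial.C α * (Polynomial.X * stablePoly α k) -
      Polynomial.C α * (Polynomial.X * (stablePoly α k).derivative)

/-- The `k`-th derivative of `l ↦ exp (-t l ^ α)`, up to the sign `(-1) ^ k`. -/
noncomputable def stableMoment (α : ℝ) (k : ℕ) (t l : ℝ) : ℝ :=
  (l ^ k)⁻¹ * (Real.exp (-(t * l ^ α)) * (stablePoly α k).eval (t * l ^ α))

/-- This yields the complete monotonicity of `l ↦ exp (-t l ^ α)`. The recursion multiplies the
coefficient of index `j` by `k - α j`, which is nonnegative for `j ≤ k`; the degree bound disposes
of the other indices. -/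
theorem stablePoly_coeff {α : ℝ} (hα0 : 0 ≤ α) (hα1 : α ≤ 1) (k : ℕ) :
    ∀ j, 0 ≤ (stablePoly α k).coeff j ∧ (k < j → (stablePoly α k).coeff j = 0) := by
  induction k with
  | zero =>
    intro j
    simp only [stablePoly, Polynomial.coeff_one]
    exact ⟨by split_ifs <;> norm_num, fun h => by simp [h.ne']⟩
  | succ k ih =>
    intro j
    rcases j with _ | j
    · simp only [stablePoly, Polynomial.coeff_sub, Polynomial.coeff_add, Polynomial.coeff_C_zero,
        Polynomial.mul_coeff_zero, Polynomial.coeff_X_zero, zero_mul, mul_zero]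
      exact ⟨by have := (ih 0).1; ring_nf; positivity, fun h => by omega⟩
    · have e : (stablePoly α (k + 1)).coeff (j + 1) =
          (k - α * (j + 1)) * (stablePoly α k).coeff (j + 1) + α * (stablePoly α k).coeff j := by
        simp only [stablePoly, Polynomial.coeff_sub, Polynomial.coeff_add, Polynomial.coeff_C_mul,
          Polynomial.coeff_X_mul, Polynomial.coeff_derivative]
        ring
      rw [e]
      refine ⟨?_, fun h => by rw [(ih _).2 (by omega), (ih _).2 (by omega)]; ring⟩
      refine add_nonneg ?_ (mul_nonneg hα0 (ih j).1)
      rcases lt_or_ge k (j + 1) with h | h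
      · rw [(ih _).2 h, mul_zero]
      · refine mul_nonneg ?_ (ih _).1
        have h' : (j : ℝ) + 1 ≤ k := by exact_mod_cast h
        nlinarith

theorem stableMoment_nonneg {α : ℝ} (hα0 : 0 ≤ α) (hα1 : α ≤ 1) (k : ℕ) {t l : ℝ} (ht : 0 ≤ t)
    (hl : 0 ≤ l) : 0 ≤ stableMoment α k t l := by
  refine mul_nonneg (by positivity) (mul_nonneg (Real.exp_pos _).le ?_)
  rw [Polynomial.eval_eq_sum_range]
  exact Finset.sum_nonneg fun j _ => mul_nonneg (stablePoly_coeff hα0 hα1 k j).1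
    (pow_nonneg (mul_nonneg ht (Real.rpow_nonneg hl _)) _)

theorem stableMoment_zero (α t l : ℝ) : stableMoment α 0 t l = Real.exp (-(t * l ^ α)) := by
  simp [stableMoment, stablePoly]

theorem stableMoment_one (α t l : ℝ) :
    stableMoment α 1 t l = l⁻¹ * (Real.exp (-(t * l ^ α)) * (α * (t * l ^ α))) := by
  simp [stableMoment, stablePoly]

theorem stableMoment_two (α t l : ℝ) :
    stableMoment α 2 t l = (l ^ 2)⁻¹ * (α * (t * l ^ α)) *
      (Real.exp (-(t * l ^ α)) * ((1 - α) + α * (t * l ^ α))) := by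
  simp [stableMoment, stablePoly]
  ring

theorem hasDerivAt_stableMoment (α : ℝ) (k : ℕ) (t : ℝ) {l : ℝ} (hl : 0 < l) :
    HasDerivAt (stableMoment α k t) (-stableMoment α (k + 1) t l) l := by
  have h1 : HasDerivAt (fun l : ℝ => t * l ^ α) (t * (α * l ^ (α - 1))) l :=
    (Real.hasDerivAt_rpow_const (Or.inl hl.ne')).const_mul t
  have h2 := (((hasDerivAt_pow k l).inv (pow_ne_zero k hl.ne')).mul
    (h1.neg.exp.mul ((Polynomial.hasDerivAt (stablePoly α k) (t * l ^ α)).comp l h1)))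
  refine h2.congr_deriv ?_
  simp only [stableMoment, stablePoly, Polynomial.eval_sub, Polynomial.eval_add,
    Polynomial.eval_mul, Polynomial.eval_C, Polynomial.eval_X, Function.comp, Pi.inv_apply,
    Pi.mul_apply, Pi.neg_apply]
  rw [Real.rpow_sub_one hl.ne']
  rcases k with _ | k
  · field_simp
    simp
    ring
  · have : (l : ℝ) ^ (k + 1 - 1) = l ^ (k + 1) / l := by
      rw [Nat.add_sub_cancel, pow_succ]; field_simp
    rw [this]
    field_simp
    ring

theorem stableMoment_antitoneOn {α : ℝ} (hα0 : 0 ≤ α) (hα1 : α ≤ 1) (k : ℕ) {t : ℝ} (ht : 0 ≤ t) :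
    AntitoneOn (stableMoment α k t) (Ioi 0) := by
  refine antitoneOn_of_deriv_nonpos (convex_Ioi 0)
    (fun l hl => (hasDerivAt_stableMoment α k t hl).continuousAt.continuousWithinAt)
    (fun l hl => (hasDerivAt_stableMoment α k t
      (interior_subset hl)).differentiableAt.differentiableWithinAt) fun l hl => ?_
  have hl' : 0 < l := interior_subset hl
  rw [(hasDerivAt_stableMoment α k t hl').deriv]
  exact neg_nonpos.2 (stableMoment_nonneg hα0 hα1 _ ht hl'.le)

theorem measurable_stableMoment (α : ℝ) (k : ℕ) (l : ℝ) :
    Measurable fun t => stableMoment α k t l := by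
  refine Continuous.measurable ?_
  unfold stableMoment
  have := (stablePoly α k).continuous
  fun_prop

theorem integrableOn_truncPow_mul_exp_mul_eval {a : ℝ} (ha : 0 ≤ a) {t μ : ℝ} (ht : 0 ≤ t)
    (hμ : 0 < μ) (P : Polynomial ℝ) :
    IntegrableOn (fun s => truncPow a (s - t) * (Real.exp (-(s * μ)) * P.eval (s * μ)))
      (Ioi 0) := by
  induction P using Polynomial.induction_on' with
  | add p q hp hq =>
    refine (hp.add hq).congr (Filter.Eventually.of_forall fun s => ?_)
    simp only [Pi.add_apply, Polynomial.eval_add]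
    ring
  | monomial j c =>
    have h := (integrableOn_rpow_mul_exp_neg_mul_rpow (p := 1) (s := a + j) (b := μ)
      (by have : (0 : ℝ) ≤ j := by positivity
          linarith) one_pos hμ).const_mul (|c| * μ ^ j)
    refine Integrable.mono' h ?_ ?_
    · have := measurable_truncPow a
      exact Measurable.aestronglyMeasurable (by
        simp only [Polynomial.eval_monomial]
        fun_prop)
    · refine (ae_restrict_iff' measurableSet_Ioi).2 (Filter.Eventually.of_forall fun s hs => ?_)
      have hs : 0 < s := hs
      have h1 : truncPow a (s - t) ≤ s ^ a := by
        rcases lt_or_ge 0 (s - t) with h | h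
        · rw [truncPow_of_pos h]
          exact Real.rpow_le_rpow h.le (by linarith) ha
        · rw [truncPow_of_nonpos h]; positivity
      rw [Polynomial.eval_monomial, Real.norm_eq_abs, abs_mul, abs_of_nonneg (truncPow_nonneg _ _),
        abs_mul, abs_of_pos (Real.exp_pos _), abs_mul,
        abs_of_nonneg (by positivity : 0 ≤ (s * μ) ^ j),
        Real.rpow_add hs, Real.rpow_natCast, Real.rpow_one, mul_pow,
        show -μ * s = -(s * μ) by ring]
      calc truncPow a (s - t) * (Real.exp (-(s * μ)) * (|c| * (s ^ j * μ ^ j)))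
          ≤ s ^ a * (Real.exp (-(s * μ)) * (|c| * (s ^ j * μ ^ j))) := by gcongr
        _ = _ := by ring

theorem integrableOn_truncPow_mul_stableMoment (α : ℝ) {a : ℝ} (ha : 0 ≤ a) (k : ℕ) {t l : ℝ}
    (ht : 0 ≤ t) (hl : 0 < l) :
    IntegrableOn (fun s => truncPow a (s - t) * stableMoment α k s l) (Ioi 0) := by
  refine ((integrableOn_truncPow_mul_exp_mul_eval ha ht (Real.rpow_pos_of_pos hl α)
    (stablePoly α k)).const_mul (l ^ k)⁻¹).congr (Filter.Eventually.of_forall fun s => ?_)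
  simp only [stableMoment]
  ring

theorem integral_truncPow_mul_exp {a : ℝ} (ha : 0 < a) {t μ : ℝ} (ht : 0 ≤ t) (hμ : 0 < μ) :
    ∫ s in Ioi (0 : ℝ), truncPow (a - 1) (s - t) * Real.exp (-(s * μ)) =
      Real.exp (-(t * μ)) * ((1 / μ) ^ a * Real.Gamma a) := by
  rw [setIntegral_eq_integral_of_forall_compl_eq_zero fun s hs => by
      rw [truncPow_of_nonpos (by have : s ≤ 0 := not_lt.1 hs
                                 linarith), zero_mul],
    ← integral_add_right_eq_self _ t,
    ← setIntegral_eq_integral_of_forall_compl_eq_zero (s := Ioi 0) fun s hs => by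
      rw [truncPow_of_nonpos (by have : s ≤ 0 := not_lt.1 hs
                                 linarith), zero_mul],
    ← Real.integral_rpow_mul_exp_neg_mul_Ioi ha hμ, ← integral_const_mul]
  refine setIntegral_congr_fun measurableSet_Ioi fun s hs => ?_
  simp only [add_sub_cancel_right]
  rw [truncPow_of_pos hs, show -((s + t) * μ) = -(t * μ) + -(μ * s) by ring, Real.exp_add]
  ring

/-- The derivatives of `exp (-t l ^ α)` in `l` are successive fractional integrals in `t`. -/
theorem stableMoment_succ {α : ℝ} (hα0 : 0 < α) (hα : 0 ≤ 1 / α - 2) (k : ℕ) {t : ℝ} (ht : 0 < t) :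
    ∀ l, 0 < l → stableMoment α (k + 1) t l = α / Real.Gamma (1 / α - 1) * t *
      ∫ s in Ioi (0 : ℝ), truncPow (1 / α - 2) (s - t) * stableMoment α k s l := by
  have hα1 : α ≤ 1 := by
    have : 2 ≤ 1 / α := by linarith
    rw [le_div_iff₀ hα0] at this
    linarith
  induction k with
  | zero =>
    intro l hl
    have hΓ : Real.Gamma (1 / α - 1) ≠ 0 := (Real.Gamma_pos_of_pos (by linarith)).ne'
    simp only [stableMoment_zero, zero_add]
    rw [show 1 / α - 2 = (1 / α - 1) - 1 by ring,
      integral_truncPow_mul_exp (by linarith) ht.le (Real.rpow_pos_of_pos hl α), stableMoment_one]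
    have : (1 / l ^ α) ^ (1 / α - 1) = l⁻¹ * l ^ α := by
      rw [one_div, ← Real.rpow_neg hl.le, ← Real.rpow_mul hl.le,
        show -α * (1 / α - 1) = -1 + α by field_simp; ring, Real.rpow_add hl, Real.rpow_neg_one]
    rw [this]
    generalize Real.Gamma (1 / α - 1) = G at hΓ
    field_simp
  | succ k ih =>
    intro l hl
    -- Both sides of the relation for `k` are differentiated in `l`; kernel and prefactor do not
    -- involve `l`. The moments decrease in `l`, so their values at `l / 2` dominate.
    have h1 := hasDerivAt_stableMoment α (k + 1) t hl
    have h2 := (hasDerivAt_integral_of_dominated_loc_of_deriv_le (𝕜 := ℝ)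
      (μ := volume.restrict (Ioi (0 : ℝ))) (x₀ := l) (s := Ioi (l / 2))
      (F := fun l s => truncPow (1 / α - 2) (s - t) * stableMoment α k s l)
      (F' := fun l s => truncPow (1 / α - 2) (s - t) * -stableMoment α (k + 1) s l)
      (bound := fun s => truncPow (1 / α - 2) (s - t) * stableMoment α (k + 1) s (l / 2))
      (Ioi_mem_nhds (by linarith))
      (Filter.Eventually.of_forall fun l' => by
        have := measurable_truncPow (1 / α - 2)
        have := measurable_stableMoment α k l'
        exact Measurable.aestronglyMeasurable (by fun_prop))
      (integrableOn_truncPow_mul_stableMoment α hα k ht.le hl)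
      (by
        have := measurable_truncPow (1 / α - 2)
        have := measurable_stableMoment α (k + 1) l
        exact Measurable.aestronglyMeasurable (by fun_prop))
      ((ae_restrict_iff' measurableSet_Ioi).2 (Filter.Eventually.of_forall fun s hs l' hl' => by
        have hs : 0 < s := hs
        have hl'' : 0 < l' := (half_pos hl).trans hl'
        rw [norm_mul, norm_neg, Real.norm_of_nonneg (truncPow_nonneg _ _),
          Real.norm_of_nonneg (stableMoment_nonneg hα0.le hα1 _ hs.le hl''.le)]
        exact mul_le_mul_of_nonneg_left (stableMoment_antitoneOn hα0.le hα1 _ hs.le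
          (half_pos hl) hl'' (le_of_lt hl')) (truncPow_nonneg _ _)))
      (integrableOn_truncPow_mul_stableMoment α hα (k + 1) ht.le (half_pos hl))
      (Filter.Eventually.of_forall fun s l' hl' =>
        (hasDerivAt_stableMoment α k s ((half_pos hl).trans hl')).const_mul _)).2.const_mul
          (α / Real.Gamma (1 / α - 1) * t)
    have h3 := h1.unique (h2.congr_of_eventuallyEq (by
      filter_upwards [Ioi_mem_nhds hl] with l' hl'
      exact ih l' hl'))
    simp only [mul_neg, integral_neg] at h3
    linarith

theorem det_stableMoment_nonneg {α : ℝ} (hα0 : 0 < α) (hα : 0 ≤ 1 / α - 2) {m : ℕ}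
    (hm : (∃ k : ℕ, 1 / α - 2 = k) ∨ (m : ℝ) - 2 ≤ 1 / α - 2) (k : ℕ) :
    ∀ t l : Fin m → ℝ, StrictMono t → StrictAnti l → (∀ i, 0 < t i) → (∀ j, 0 < l j) →
      0 ≤ (Matrix.of fun i j => stableMoment α k (t i) (l j)).det := by
  induction k with
  | zero =>
    intro t l ht hl _ hl0
    simp only [stableMoment_zero]
    exact det_exp_neg_mul_nonneg (μ := fun j => l j ^ α) ht
      (fun i j hij => Real.rpow_lt_rpow (hl0 j).le (hl hij) hα0)
      fun j => Real.rpow_pos_of_pos (hl0 j) α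
  | succ k ih =>
    intro t l ht hl ht0 hl0
    have hA : (Matrix.of fun i j => stableMoment α (k + 1) (t i) (l j)) =
        Matrix.of fun i j => (α / Real.Gamma (1 / α - 1) * t i) *
          (Matrix.of fun i j => ∫ s in Ioi (0 : ℝ),
            truncPow (1 / α - 2) (s - t i) * stableMoment α k s (l j)) i j := by
      ext i j
      exact stableMoment_succ hα0 hα k (ht0 i) _ (hl0 j)
    rw [hA, Matrix.det_mul_column]
    have hΓ : 0 < Real.Gamma (1 / α - 1) := Real.Gamma_pos_of_pos (by linarith)
    refine mul_nonneg (Finset.prod_nonneg fun i _ => by have := ht0 i; positivity) ?_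
    refine det_integral_mul_nonneg (volume.restrict (Ioi (0 : ℝ))) (I := Ioi 0)
      (ae_restrict_mem measurableSet_Ioi)
      (K := fun i s => truncPow (1 / α - 2) (s - t i))
      (L := fun s j => stableMoment α k s (l j))
      (fun i j => integrableOn_truncPow_mul_stableMoment α hα k (ht0 i).le (hl0 j))
      (fun s hs _ => det_truncPow_nonneg m _ hm t s ht hs)
      (fun s hs hs0 => ih s l hs hl hs0 hl0)

/-! ### Laplace transforms: moments and the Post–Widder inversion formula -/

/-- Half of the exponential absorbs the power: `x ^ k * exp (-(l / 2 * x))` is bounded. -/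
theorem integrableOn_pow_mul_of_laplace {f : ℝ → ℝ}
    (hf : ∀ l : ℝ, 0 < l → IntegrableOn (fun x => f x * Real.exp (-(l * x))) (Ioi 0))
    (k : ℕ) {l : ℝ} (hl : 0 < l) :
    IntegrableOn (fun x => x ^ k * (f x * Real.exp (-(l * x)))) (Ioi 0) := by
  have hl2 := half_pos hl
  refine Integrable.mono' ((hf (l / 2) hl2).norm.const_mul (k.factorial / (l / 2) ^ k)) ?_ ?_
  · exact (continuous_pow k).aestronglyMeasurable.mul (hf l hl).aestronglyMeasurable
  · refine (ae_restrict_iff' measurableSet_Ioi).2 (Filter.Eventually.of_forall fun x hx => ?_)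
    have hx : 0 < x := hx
    have h := Real.pow_div_factorial_le_exp (l / 2 * x) (by positivity) k
    rw [div_le_iff₀ (by positivity), mul_pow] at h
    rw [norm_mul, norm_mul, norm_mul, Real.norm_of_nonneg (by positivity : 0 ≤ x ^ k),
      Real.norm_of_nonneg (Real.exp_pos _).le, Real.norm_of_nonneg (Real.exp_pos _).le]
    have e : Real.exp (-(l * x)) = Real.exp (-(l / 2 * x)) * (Real.exp (l / 2 * x))⁻¹ := by
      rw [← Real.exp_neg, ← Real.exp_add]; congr 1; ring
    have h' : x ^ k * (Real.exp (l / 2 * x))⁻¹ ≤ k.factorial / (l / 2) ^ k := by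
      rw [← div_eq_mul_inv, div_le_div_iff₀ (Real.exp_pos _) (by positivity)]
      linarith
    calc x ^ k * (‖f x‖ * Real.exp (-(l * x)))
        = (x ^ k * (Real.exp (l / 2 * x))⁻¹) * (‖f x‖ * Real.exp (-(l / 2 * x))) := by
          rw [e]; ring
      _ ≤ _ := by gcongr

theorem hasDerivAt_laplace_moment {f : ℝ → ℝ}
    (hf : ∀ l : ℝ, 0 < l → IntegrableOn (fun x => f x * Real.exp (-(l * x))) (Ioi 0))
    (k : ℕ) {l : ℝ} (hl : 0 < l) :
    HasDerivAt (fun l => ∫ x in Ioi (0 : ℝ), x ^ k * (f x * Real.exp (-(l * x))))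
      (-∫ x in Ioi (0 : ℝ), x ^ (k + 1) * (f x * Real.exp (-(l * x)))) l := by
  have h := (hasDerivAt_integral_of_dominated_loc_of_deriv_le (𝕜 := ℝ)
    (μ := volume.restrict (Ioi (0 : ℝ))) (x₀ := l) (s := Ioi (l / 2))
    (F := fun l x => x ^ k * (f x * Real.exp (-(l * x))))
    (F' := fun l x => -(x ^ (k + 1) * (f x * Real.exp (-(l * x)))))
    (bound := fun x => ‖x ^ (k + 1) * (f x * Real.exp (-(l / 2 * x)))‖)
    (Ioi_mem_nhds (by linarith))
    (by
      filter_upwards [Ioi_mem_nhds hl] with l' hl'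
      exact (integrableOn_pow_mul_of_laplace hf k hl').aestronglyMeasurable)
    (integrableOn_pow_mul_of_laplace hf k hl)
    (integrableOn_pow_mul_of_laplace hf (k + 1) hl).aestronglyMeasurable.neg
    ((ae_restrict_iff' measurableSet_Ioi).2 (Filter.Eventually.of_forall fun x hx l' hl' => by
      have hx : 0 < x := hx
      have hl' : l / 2 < l' := hl'
      rw [norm_neg, norm_mul, norm_mul, norm_mul, norm_mul, Real.norm_of_nonneg (Real.exp_pos _).le,
        Real.norm_of_nonneg (Real.exp_pos _).le]
      gcongr))
    (integrableOn_pow_mul_of_laplace hf (k + 1) (half_pos hl)).norm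
    (Filter.Eventually.of_forall fun x l' hl' => by
      have h1 : HasDerivAt (fun l : ℝ => -(l * x)) (-(1 * x)) l' :=
        ((hasDerivAt_id l').mul_const x).neg
      refine ((h1.exp.const_mul (f x)).const_mul (x ^ k)).congr_deriv ?_
      ring)).2
  rwa [integral_neg] at h

theorem laplace_moment_eq_stableMoment {α t : ℝ} {f : ℝ → ℝ}
    (hf : ∀ l : ℝ, 0 < l → IntegrableOn (fun x => f x * Real.exp (-(l * x))) (Ioi 0))
    (hL : ∀ l : ℝ, 0 < l → ∫ x in Ioi (0 : ℝ), f x * Real.exp (-(l * x)) = Real.exp (-(t * l ^ α)))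
    (k : ℕ) : ∀ l : ℝ, 0 < l →
      ∫ x in Ioi (0 : ℝ), x ^ k * (f x * Real.exp (-(l * x))) = stableMoment α k t l := by
  induction k with
  | zero => intro l hl; simpa [stableMoment_zero] using hL l hl
  | succ k ih =>
    intro l hl
    have h := (hasDerivAt_laplace_moment hf k hl).unique
      ((hasDerivAt_stableMoment α k t hl).congr_of_eventuallyEq (by
        filter_upwards [Ioi_mem_nhds hl] with l' hl'
        exact ih l' hl'))
    linarith

/-- Uniqueness of the maximum is what makes the powers of `negMulLog` concentrate at `exp (-1)` in
the Post–Widder formula. -/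
theorem negMulLog_lt_exp_neg_one {y : ℝ} (hy : 0 ≤ y) (hne : y ≠ Real.exp (-1)) :
    Real.negMulLog y < Real.exp (-1) := by
  rcases hy.eq_or_lt with rfl | hy
  · simpa using Real.exp_pos (-1)
  · have hz : -Real.log y - 1 ≠ 0 := fun h => hne (by
      rw [← Real.exp_log hy]; congr 1; linarith)
    have h := Real.add_one_lt_exp hz
    have e : Real.exp (-Real.log y - 1) = y⁻¹ * Real.exp (-1) := by
      rw [sub_eq_add_neg, Real.exp_add, Real.exp_neg, Real.exp_log hy]
    rw [e, sub_add_cancel] at h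
    calc Real.negMulLog y = y * (-Real.log y) := by rw [Real.negMulLog]; ring
      _ < y * (y⁻¹ * Real.exp (-1)) := by gcongr
      _ = Real.exp (-1) := by field_simp

theorem image_exp_neg_div {x : ℝ} (hx : 0 < x) :
    (fun y => Real.exp (-(y / x))) '' Ioi 0 = Ioo 0 1 := by
  ext v
  constructor
  · rintro ⟨y, hy, rfl⟩
    have hy : 0 < y := hy
    exact ⟨Real.exp_pos _, Real.exp_lt_one_iff.2 (by have := div_pos hy hx; linarith)⟩
  · rintro ⟨h0, h1⟩
    refine ⟨-(x * Real.log v), ?_, ?_⟩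
    · have := mul_pos hx (neg_pos.2 (Real.log_neg h0 h1))
      simp only [mem_Ioi]; linarith
    · have : -(-(x * Real.log v) / x) = Real.log v := by field_simp
      simp only [this, Real.exp_log h0]

/-- Post–Widder inversion of the Laplace transform. -/
theorem tendsto_postWidder {f : ℝ → ℝ}
    (hf : ∀ l : ℝ, 0 < l → IntegrableOn (fun x => f x * Real.exp (-(l * x))) (Ioi 0))
    (hc : ContinuousOn f (Ioi 0)) {x : ℝ} (hx : 0 < x) :
    Filter.Tendsto (fun n : ℕ => (∫ v in Icc (0 : ℝ) 1, Real.negMulLog v ^ n)⁻¹ *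
      ((x ^ (n + 1))⁻¹ * ∫ y in Ioi (0 : ℝ), y ^ n * (f y * Real.exp (-((n + 1) / x * y)))))
      Filter.atTop (nhds (f x)) := by
  have hder : ∀ y ∈ Ioi (0 : ℝ), HasDerivWithinAt (fun y => Real.exp (-(y / x)))
      (Real.exp (-(y / x)) * -(1 / x)) (Ioi 0) y := fun y _ =>
    (((hasDerivAt_id y).div_const x).neg.exp).hasDerivWithinAt
  have hinj : InjOn (fun y => Real.exp (-(y / x))) (Ioi 0) := fun y _ z _ h => by
    have := Real.exp_injective h
    field_simp at this
    linarith
  have habs : ∀ y, |Real.exp (-(y / x)) * -(1 / x)| = Real.exp (-(y / x)) * (1 / x) := fun y => by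
    rw [abs_mul, abs_neg, abs_of_pos (Real.exp_pos _), abs_of_pos (by positivity)]
  have hlog : ∀ y, -(x * Real.log (Real.exp (-(y / x)))) = y := fun y => by
    rw [Real.log_exp]; field_simp
  -- Substituting `v = exp (-y / x)` turns `y ^ n * exp (-n y / x)` into a multiple of `negMulLog v
  -- ^ n` on `(0, 1)`, with peak `v = exp (-1)` corresponding to `y = x`.
  set g : ℝ → ℝ := fun v => f (-(x * Real.log v)) with hg
  have hgint : IntegrableOn g (Icc 0 1) := by
    rw [integrableOn_Icc_iff_integrableOn_Ioo, ← image_exp_neg_div hx,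
      integrableOn_image_iff_integrableOn_abs_deriv_smul measurableSet_Ioi hder hinj]
    refine ((hf (1 / x) (by positivity)).const_mul (1 / x)).congr
      (Filter.Eventually.of_forall fun y => ?_)
    simp only [habs, hg, hlog, smul_eq_mul]
    rw [show -(1 / x * y) = -(y / x) by ring]
    ring
  have he1 : Real.exp (-1) < 1 := Real.exp_lt_one_iff.2 (by norm_num)
  have hm : Real.negMulLog (Real.exp (-1)) = Real.exp (-1) := by simp [Real.negMulLog]
  have hgx : g (Real.exp (-1)) = f x := by simp [hg]
  have key := tendsto_setIntegral_pow_smul_of_unique_maximum_of_isCompact_of_integrableOn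
    (μ := volume) (g := g) (x₀ := Real.exp (-1)) (s := Icc (0 : ℝ) 1) isCompact_Icc
    (c := Real.negMulLog) Real.continuous_negMulLog.continuousOn
    (fun y hy hne => by rw [hm]; exact negMulLog_lt_exp_neg_one hy.1 hne)
    (fun y hy => Real.negMulLog_nonneg hy.1 hy.2) (by rw [hm]; exact Real.exp_pos _)
    (by
      rw [interior_Icc, closure_Ioo (by norm_num)]
      exact ⟨(Real.exp_pos _).le, he1.le⟩) hgint
    (by
      have h1 : ContinuousAt (fun v => -(x * Real.log v)) (Real.exp (-1)) :=
        ((Real.continuousAt_log (Real.exp_pos _).ne').const_mul x).neg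
      have h2 : ContinuousAt f (-(x * Real.log (Real.exp (-1)))) := by
        have : -(x * Real.log (Real.exp (-1))) = x := by simp
        rw [this]
        exact hc.continuousAt (Ioi_mem_nhds hx)
      exact (ContinuousAt.comp (f := fun v => -(x * Real.log v)) h2 h1).continuousWithinAt)
  rw [hgx] at key
  refine key.congr fun n => ?_
  rw [smul_eq_mul, integral_Icc_eq_integral_Ioc (f := fun v => _ • g v),
    integral_Ioc_eq_integral_Ioo, ← image_exp_neg_div hx,
    integral_image_eq_integral_abs_deriv_smul measurableSet_Ioi hder hinj]
  congr 1
  rw [← integral_const_mul]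
  refine setIntegral_congr_fun measurableSet_Ioi fun y _ => ?_
  simp only [habs, hg, smul_eq_mul, Real.negMulLog, Real.log_exp]
  -- The extra `1` in `n + 1` is the Jacobian of the substitution.
  have e : Real.exp (-((n + 1) / x * y)) = Real.exp (-(y / x)) * Real.exp (-(y / x)) ^ n := by
    rw [← Real.exp_nat_mul, ← Real.exp_add]; congr 1; field_simp; ring
  rw [e, neg_mul_neg, mul_pow, div_pow]
  field_simp
  ring

theorem postWidder_weight_nonneg (n : ℕ) :
    0 ≤ (∫ v in Icc (0 : ℝ) 1, Real.negMulLog v ^ n)⁻¹ :=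
  inv_nonneg.2 (setIntegral_nonneg measurableSet_Icc fun _ hv =>
    pow_nonneg (Real.negMulLog_nonneg hv.1 hv.2) n)

/-- Supplies the positivity of the density, which complex inversion does not show. -/
theorem nonneg_of_laplace_eq_exp_neg_rpow {α t : ℝ} (hα0 : 0 ≤ α) (hα1 : α ≤ 1) (ht : 0 ≤ t)
    {f : ℝ → ℝ}
    (hf : ∀ l : ℝ, 0 < l → IntegrableOn (fun x => f x * Real.exp (-(l * x))) (Ioi 0))
    (hc : ContinuousOn f (Ioi 0))
    (hL : ∀ l : ℝ, 0 < l → ∫ x in Ioi (0 : ℝ), f x * Real.exp (-(l * x)) = Real.exp (-(t * l ^ α)))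
    {x : ℝ} (hx : 0 < x) : 0 ≤ f x := by
  refine ge_of_tendsto' (tendsto_postWidder hf hc hx) fun n => ?_
  rw [laplace_moment_eq_stableMoment hf hL n _ (by positivity)]
  exact mul_nonneg (postWidder_weight_nonneg n)
    (mul_nonneg (by positivity) (stableMoment_nonneg hα0 hα1 n ht (by positivity)))

/-! ### Sufficiency -/

theorem det_stableKernel_nonneg {α : ℝ} (hα0 : 0 < α) {p : ℝ → ℝ → ℝ}
    (hp : IsPositiveStableKernel α p) (hα : 0 ≤ 1 / α - 2) {m : ℕ}
    (hm : (∃ k : ℕ, 1 / α - 2 = k) ∨ (m : ℝ) - 2 ≤ 1 / α - 2) {t x : Fin m → ℝ}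
    (ht : StrictMono t) (hx : StrictMono x) (ht0 : ∀ i, 0 < t i) (hx0 : ∀ j, 0 < x j) :
    0 ≤ (Matrix.of fun i j => p (t i) (x j)).det := by
  have hlim : Filter.Tendsto (fun n : ℕ => (Matrix.of fun i j =>
      ((∫ v in Icc (0 : ℝ) 1, Real.negMulLog v ^ n)⁻¹ * (x j ^ (n + 1))⁻¹) *
        (Matrix.of fun i j => stableMoment α n (t i) ((n + 1) / x j)) i j).det) Filter.atTop
      (nhds (Matrix.of fun i j => p (t i) (x j)).det) := by
    refine ((continuous_id.matrix_det).tendsto _).comp ?_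
    refine tendsto_pi_nhds.2 fun i => tendsto_pi_nhds.2 fun j => ?_
    refine (tendsto_postWidder (hp.integrableOn _ (ht0 i)) (hp.continuousOn _ (ht0 i))
      (hx0 j)).congr fun n => ?_
    rw [laplace_moment_eq_stableMoment (hp.integrableOn _ (ht0 i)) (hp.laplace _ (ht0 i)) n _
      (by have := hx0 j; positivity), ← mul_assoc]
    rfl
  refine ge_of_tendsto' hlim fun n => ?_
  rw [Matrix.det_mul_row]
  refine mul_nonneg (Finset.prod_nonneg fun j _ => mul_nonneg (postWidder_weight_nonneg n)
    (by have := hx0 j; positivity)) ?_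
  refine det_stableMoment_nonneg hα0 hα hm n t (fun j => (n + 1) / x j) ht (fun i j hij => ?_) ht0
    fun j => by have := hx0 j; positivity
  exact div_lt_div_of_pos_left (by positivity) (hx0 i) (hx hij)

/-! ### Existence of the stable density -/

open FourierTransform in
theorem continuous_fourierInv_of_integrable {g : ℝ → ℂ} (hg : Integrable g) :
    Continuous (𝓕⁻ g) := by
  have h : Continuous (𝓕 g) := VectorFourier.fourierIntegral_continuous Real.continuous_fourierChar
    (innerSL ℝ).continuous₂ hg
  have e : 𝓕⁻ g = fun x => 𝓕 g (-x) := funext fun x => Real.fourierInv_eq_fourier_neg g x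
  rw [e]
  exact h.comp continuous_neg

theorem integrable_exp_neg_mul_abs_rpow {α κ : ℝ} (hα : 0 < α) (hκ : 0 < κ) :
    Integrable fun ξ : ℝ => Real.exp (-κ * |ξ| ^ α) := by
  -- A non-integrable function has integral `0` by convention, whereas the Gamma formula gives a
  -- positive value.
  by_contra h
  have h1 := integral_comp_abs (f := fun x => Real.exp (-κ * x ^ α))
  rw [integral_undef h, integral_exp_neg_mul_rpow hα hκ] at h1
  have := Real.Gamma_pos_of_pos (show 0 < 1 / α + 1 by positivity)
  have := Real.rpow_pos_of_pos hκ (-1 / α)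
  have : 0 < κ ^ (-1 / α) * Real.Gamma (1 / α + 1) := by positivity
  linarith

/-- The point `l + 2πiξ` of the vertical line of abscissa `l`. -/
noncomputable def linePoint (l ξ : ℝ) : ℂ := l + (2 * Real.pi * ξ : ℝ) * Complex.I

theorem linePoint_re (l ξ : ℝ) : (linePoint l ξ).re = l := by simp [linePoint]

theorem linePoint_mem_slitPlane {l : ℝ} (hl : 0 < l) (ξ : ℝ) :
    linePoint l ξ ∈ Complex.slitPlane := Or.inl (by rwa [linePoint_re])

theorem le_norm_linePoint (l ξ : ℝ) : l ≤ ‖linePoint l ξ‖ := by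
  simpa [linePoint_re] using Complex.re_le_norm (linePoint l ξ)

theorem abs_le_norm_linePoint (l ξ : ℝ) : |ξ| ≤ ‖linePoint l ξ‖ := by
  have h := Complex.abs_im_le_norm (linePoint l ξ)
  have h1 : (linePoint l ξ).im = 2 * Real.pi * ξ := by simp [linePoint]
  rw [h1, abs_mul, abs_of_pos Real.two_pi_pos] at h
  nlinarith [abs_nonneg ξ, Real.pi_gt_three]

/-- The integrand of the inversion formula for the stable density. -/
noncomputable def stableIntegrand (α x l ξ : ℝ) : ℂ :=
  Complex.exp (x * linePoint l ξ - linePoint l ξ ^ (α : ℂ))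

/-- In the right half-plane `|arg z| ≤ π / 2`, so the real part of `z ^ α` is at least `cos (π α /
2) * |z| ^ α`. -/
theorem norm_stableIntegrand_le {α : ℝ} (hα0 : 0 < α) (hα1 : α < 1) (x : ℝ) {l : ℝ} (hl : 0 < l)
    (ξ : ℝ) : ‖stableIntegrand α x l ξ‖ ≤
      Real.exp (x * l) * Real.exp (-Real.cos (Real.pi / 2 * α) * |ξ| ^ α) := by
  rw [stableIntegrand, Complex.norm_exp, ← Real.exp_add, Real.exp_le_exp, Complex.sub_re,
    Complex.re_ofReal_mul, linePoint_re, Complex.cpow_ofReal_re]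
  have hπ := Real.pi_pos
  have harg : |Complex.arg (linePoint l ξ)| ≤ Real.pi / 2 :=
    Complex.abs_arg_le_pi_div_two_iff.2 (by rw [linePoint_re]; exact hl.le)
  have hcos : Real.cos (Real.pi / 2 * α) ≤ Real.cos (Complex.arg (linePoint l ξ) * α) := by
    rw [← Real.cos_abs (Complex.arg _ * α), abs_mul, abs_of_pos hα0]
    refine Real.cos_le_cos_of_nonneg_of_le_pi (by positivity) ?_ (by gcongr)
    nlinarith
  have hκ : 0 ≤ Real.cos (Real.pi / 2 * α) :=
    Real.cos_nonneg_of_mem_Icc ⟨by nlinarith, by nlinarith⟩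
  have h1 : |ξ| ^ α ≤ ‖linePoint l ξ‖ ^ α :=
    Real.rpow_le_rpow (abs_nonneg _) (abs_le_norm_linePoint l ξ) hα0.le
  have h2 := mul_le_mul h1 hcos hκ (by positivity)
  linarith

theorem cos_pi_div_two_mul_pos {α : ℝ} (hα0 : 0 < α) (hα1 : α < 1) :
    0 < Real.cos (Real.pi / 2 * α) := by
  have hπ := Real.pi_pos
  exact Real.cos_pos_of_mem_Ioo ⟨by nlinarith, by nlinarith⟩

theorem continuous_stableIntegrand (α x : ℝ) {l : ℝ} (hl : 0 < l) :
    Continuous (stableIntegrand α x l) := by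
  have h1 : Continuous (linePoint l) := by unfold linePoint; fun_prop
  have h2 : Continuous fun ξ => linePoint l ξ ^ (α : ℂ) :=
    h1.cpow continuous_const fun ξ => linePoint_mem_slitPlane hl ξ
  unfold stableIntegrand
  fun_prop

theorem integrable_stableIntegrand {α : ℝ} (hα0 : 0 < α) (hα1 : α < 1) (x : ℝ) {l : ℝ}
    (hl : 0 < l) : Integrable (stableIntegrand α x l) :=
  Integrable.mono' ((integrable_exp_neg_mul_abs_rpow hα0
    (cos_pi_div_two_mul_pos hα0 hα1)).const_mul _)
    (continuous_stableIntegrand α x hl).aestronglyMeasurable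
    (Filter.Eventually.of_forall (norm_stableIntegrand_le hα0 hα1 x hl))

/-- The derivative of `exp (x z - z ^ α)` at `z = l + 2πiξ`. -/
noncomputable def stableIntegrandDeriv (α x l ξ : ℝ) : ℂ :=
  stableIntegrand α x l ξ * (x - α * linePoint l ξ ^ ((α : ℂ) - 1))

theorem hasDerivAt_exp_sub_cpow (α x : ℝ) {l : ℝ} (hl : 0 < l) (ξ : ℝ) :
    HasDerivAt (fun z : ℂ => Complex.exp (x * z - z ^ (α : ℂ))) (stableIntegrandDeriv α x l ξ)
      (linePoint l ξ) := by
  have h := (((hasDerivAt_id (linePoint l ξ)).const_mul (x : ℂ)).sub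
    ((hasDerivAt_id (linePoint l ξ)).cpow_const (c := (α : ℂ))
      (linePoint_mem_slitPlane hl ξ))).cexp
  refine h.congr_deriv ?_
  simp [stableIntegrandDeriv, stableIntegrand]

theorem hasDerivAt_stableIntegrand_abscissa (α x : ℝ) {l : ℝ} (hl : 0 < l) (ξ : ℝ) :
    HasDerivAt (fun l => stableIntegrand α x l ξ) (stableIntegrandDeriv α x l ξ) l := by
  have h1 : HasDerivAt (fun l : ℝ => linePoint l ξ) 1 l :=
    (Complex.ofRealCLM.hasDerivAt (x := l)).add_const _
  have h := (hasDerivAt_exp_sub_cpow α x hl ξ).comp l h1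
  rw [mul_one] at h
  exact h

theorem hasDerivAt_stableIntegrand_ordinate (α x : ℝ) {l : ℝ} (hl : 0 < l) (ξ : ℝ) :
    HasDerivAt (stableIntegrand α x l)
      (stableIntegrandDeriv α x l ξ * (2 * Real.pi * Complex.I)) ξ := by
  have h1 : HasDerivAt (fun ξ : ℝ => linePoint l ξ) (2 * Real.pi * Complex.I) ξ := by
    have h := (((Complex.ofRealCLM.hasDerivAt (x := ξ)).const_mul (2 * Real.pi : ℂ)).mul_const
      Complex.I).const_add (l : ℂ)
    refine (h.congr_deriv (by simp)).congr_of_eventuallyEq (Filter.Eventually.of_forall fun ξ => ?_)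
    simp [linePoint]
  exact (hasDerivAt_exp_sub_cpow α x hl ξ).comp ξ h1

theorem norm_stableIntegrandDeriv_le {α : ℝ} (hα0 : 0 < α) (hα1 : α < 1) (x : ℝ) {l₀ l₁ l : ℝ}
    (h0 : 0 < l₀) (hl0 : l₀ ≤ l) (hl1 : l ≤ l₁) (ξ : ℝ) :
    ‖stableIntegrandDeriv α x l ξ‖ ≤ Real.exp (|x| * l₁) * (|x| + α * l₀ ^ (α - 1)) *
      Real.exp (-Real.cos (Real.pi / 2 * α) * |ξ| ^ α) := by
  have hl : 0 < l := h0.trans_le hl0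
  have h1 := norm_stableIntegrand_le hα0 hα1 x hl ξ
  have h2 : Real.exp (x * l) ≤ Real.exp (|x| * l₁) := by
    refine Real.exp_le_exp.2 ?_
    calc x * l ≤ |x| * l := by gcongr; exact le_abs_self x
      _ ≤ |x| * l₁ := by gcongr
  have h3 : ‖(x : ℂ) - α * linePoint l ξ ^ ((α : ℂ) - 1)‖ ≤ |x| + α * l₀ ^ (α - 1) := by
    refine (norm_sub_le _ _).trans ?_
    have e : (α : ℂ) - 1 = ((α - 1 : ℝ) : ℂ) := by simp
    rw [norm_mul, e, Complex.norm_cpow_real, Complex.norm_real, Complex.norm_real,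
      Real.norm_eq_abs, Real.norm_of_nonneg hα0.le]
    have := Real.rpow_le_rpow_of_nonpos h0 (hl0.trans (le_norm_linePoint l ξ))
      (by linarith : α - 1 ≤ 0)
    gcongr
  rw [stableIntegrandDeriv, norm_mul]
  calc _ ≤ (Real.exp (|x| * l₁) * Real.exp (-Real.cos (Real.pi / 2 * α) * |ξ| ^ α)) *
        (|x| + α * l₀ ^ (α - 1)) := by
        refine mul_le_mul (h1.trans ?_) h3 (norm_nonneg _) (by positivity)
        gcongr
    _ = _ := by ring

theorem continuous_stableIntegrandDeriv (α x : ℝ) {l : ℝ} (hl : 0 < l) :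
    Continuous (stableIntegrandDeriv α x l) := by
  have h1 : Continuous (linePoint l) := by unfold linePoint; fun_prop
  have h2 : Continuous fun ξ => linePoint l ξ ^ ((α : ℂ) - 1) :=
    h1.cpow continuous_const fun ξ => linePoint_mem_slitPlane hl ξ
  have h3 := continuous_stableIntegrand α x hl
  unfold stableIntegrandDeriv
  fun_prop

/-- Contour shift without contours: by holomorphy the derivative in the abscissa is, up to `2πi`,
the derivative in the ordinate, whose integral over the line vanishes. -/
theorem hasDerivAt_integral_stableIntegrand {α : ℝ} (hα0 : 0 < α) (hα1 : α < 1) (x : ℝ) {l : ℝ}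
    (hl : 0 < l) : HasDerivAt (fun l => ∫ ξ, stableIntegrand α x l ξ) 0 l := by
  have hw := integrable_exp_neg_mul_abs_rpow hα0 (cos_pi_div_two_mul_pos hα0 hα1)
  have h := hasDerivAt_integral_of_dominated_loc_of_deriv_le (𝕜 := ℝ) (μ := volume)
    (x₀ := l) (s := Ioo (l / 2) (2 * l)) (F := fun l ξ => stableIntegrand α x l ξ)
    (F' := fun l ξ => stableIntegrandDeriv α x l ξ)
    (bound := fun ξ => Real.exp (|x| * (2 * l)) * (|x| + α * (l / 2) ^ (α - 1)) *
      Real.exp (-Real.cos (Real.pi / 2 * α) * |ξ| ^ α))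
    (Ioo_mem_nhds (by linarith) (by linarith))
    (by
      filter_upwards [Ioi_mem_nhds hl] with l' hl'
      exact (continuous_stableIntegrand α x hl').aestronglyMeasurable)
    (integrable_stableIntegrand hα0 hα1 x hl)
    (continuous_stableIntegrandDeriv α x hl).aestronglyMeasurable
    (Filter.Eventually.of_forall fun ξ l' hl' =>
      norm_stableIntegrandDeriv_le hα0 hα1 x (half_pos hl) hl'.1.le hl'.2.le ξ)
    (hw.const_mul _)
    (Filter.Eventually.of_forall fun ξ l' hl' =>
      hasDerivAt_stableIntegrand_abscissa α x ((half_pos hl).trans hl'.1) ξ)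
  have h0 := integral_eq_zero_of_hasDerivAt_of_integrable
    (hasDerivAt_stableIntegrand_ordinate α x hl) (h.1.mul_const _)
    (integrable_stableIntegrand hα0 hα1 x hl)
  rw [integral_mul_const] at h0
  have h1 : ∫ ξ, stableIntegrandDeriv α x l ξ = 0 := by
    refine (mul_eq_zero.1 h0).resolve_right ?_
    simp [Real.pi_ne_zero]
  exact h1 ▸ h.2

theorem integral_stableIntegrand_eq {α : ℝ} (hα0 : 0 < α) (hα1 : α < 1) (x : ℝ) {l : ℝ}
    (hl : 0 < l) : ∫ ξ, stableIntegrand α x l ξ = ∫ ξ, stableIntegrand α x 1 ξ :=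
  isOpen_Ioi.is_const_of_deriv_eq_zero (s := Ioi (0 : ℝ))
    (f := fun l => ∫ ξ, stableIntegrand α x l ξ) isPreconnected_Ioi
    (fun _ hl => (hasDerivAt_integral_stableIntegrand hα0 hα1 x
      hl).differentiableAt.differentiableWithinAt)
    (fun _ hl => (hasDerivAt_integral_stableIntegrand hα0 hα1 x hl).deriv) hl
    (mem_Ioi.2 one_pos)

/-- The density of the positive `α`-stable law, as a complex valued function on `ℝ`. -/
noncomputable def stableInversion (α x : ℝ) : ℂ := ∫ ξ, stableIntegrand α x 1 ξ

theorem norm_stableInversion_le {α : ℝ} (hα0 : 0 < α) (hα1 : α < 1) (x : ℝ) {l : ℝ} (hl : 0 < l) :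
    ‖stableInversion α x‖ ≤ Real.exp (x * l) *
      ∫ ξ : ℝ, Real.exp (-Real.cos (Real.pi / 2 * α) * |ξ| ^ α) := by
  rw [stableInversion, ← integral_stableIntegrand_eq hα0 hα1 x hl, ← integral_const_mul]
  exact norm_integral_le_of_norm_le ((integrable_exp_neg_mul_abs_rpow hα0
    (cos_pi_div_two_mul_pos hα0 hα1)).const_mul _)
    (Filter.Eventually.of_forall (norm_stableIntegrand_le hα0 hα1 x hl))

/-- The abscissa is pushed to `+∞`, where the factor `exp (x * l)` kills the bound. -/
theorem stableInversion_of_neg {α : ℝ} (hα0 : 0 < α) (hα1 : α < 1) {x : ℝ} (hx : x < 0) :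
    stableInversion α x = 0 := by
  have hlim : Filter.Tendsto (fun l : ℝ => Real.exp (x * l) *
      ∫ ξ : ℝ, Real.exp (-Real.cos (Real.pi / 2 * α) * |ξ| ^ α)) Filter.atTop (nhds 0) := by
    have h := (Real.tendsto_exp_atBot.comp
      (Filter.tendsto_id.const_mul_atTop_of_neg hx)).mul_const
      (∫ ξ : ℝ, Real.exp (-Real.cos (Real.pi / 2 * α) * |ξ| ^ α))
    simpa using h
  refine norm_le_zero_iff.1 (ge_of_tendsto hlim ?_)
  filter_upwards [Filter.eventually_gt_atTop 0] with l hl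
  exact norm_stableInversion_le hα0 hα1 x hl

open FourierTransform in
theorem fourierInv_stableIntegrand {α : ℝ} (hα0 : 0 < α) (hα1 : α < 1) {l : ℝ} (hl : 0 < l)
    (x : ℝ) : 𝓕⁻ (stableIntegrand α 0 l) x = Real.exp (-(l * x)) * stableInversion α x := by
  rw [stableInversion, ← integral_stableIntegrand_eq hα0 hα1 x hl, ← integral_const_mul,
    Real.fourierInv_eq']
  congr 1
  funext ξ
  simp only [stableIntegrand, smul_eq_mul, linePoint]
  rw [Complex.ofReal_exp, ← Complex.exp_add, ← Complex.exp_add]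
  congr 1
  simp
  ring

theorem continuous_stableInversion {α : ℝ} (hα0 : 0 < α) (hα1 : α < 1) :
    Continuous (stableInversion α) := by
  have h := continuous_fourierInv_of_integrable (integrable_stableIntegrand hα0 hα1 0 one_pos)
  have e : stableInversion α = fun x => (Real.exp x : ℂ) *
      FourierTransformInv.fourierInv (stableIntegrand α 0 1) x := by
    funext x
    rw [fourierInv_stableIntegrand hα0 hα1 one_pos, ← mul_assoc, ← Complex.ofReal_mul,
      ← Real.exp_add]
    simp
  rw [e]
  fun_prop

theorem integrable_exp_mul_stableInversion {α : ℝ} (hα0 : 0 < α) (hα1 : α < 1) {l : ℝ}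
    (hl : 0 < l) : Integrable fun x : ℝ => (Real.exp (-(l * x)) : ℂ) * stableInversion α x := by
  set W := ∫ ξ : ℝ, Real.exp (-Real.cos (Real.pi / 2 * α) * |ξ| ^ α) with hW
  have hb : Integrable ((Ici (0 : ℝ)).indicator fun x => W * Real.exp (-(l / 2) * x)) := by
    rw [integrable_indicator_iff measurableSet_Ici, integrableOn_Ici_iff_integrableOn_Ioi]
    exact (exp_neg_integrableOn_Ioi 0 (half_pos hl)).const_mul W
  refine hb.mono' ?_ (Filter.Eventually.of_forall fun x => ?_)
  · have := continuous_stableInversion hα0 hα1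
    exact Continuous.aestronglyMeasurable (by fun_prop)
  · rcases lt_or_ge x 0 with hx | hx
    · simp [stableInversion_of_neg hα0 hα1 hx, hx]
    · rw [indicator_of_mem (mem_Ici.2 hx), norm_mul, Complex.norm_real,
        Real.norm_of_nonneg (Real.exp_pos _).le]
      calc _ ≤ Real.exp (-(l * x)) * (Real.exp (x * (l / 2)) * W) := by
            gcongr
            exact norm_stableInversion_le hα0 hα1 x (half_pos hl)
        _ = W * (Real.exp (-(l * x)) * Real.exp (x * (l / 2))) := by ring
        _ = _ := by rw [← Real.exp_add]; congr 2; ring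

open FourierTransform in
theorem integral_exp_mul_stableInversion {α : ℝ} (hα0 : 0 < α) (hα1 : α < 1) {l : ℝ}
    (hl : 0 < l) :
    ∫ x : ℝ, (Real.exp (-(l * x)) : ℂ) * stableInversion α x = Real.exp (-(l ^ α)) := by
  have e : 𝓕⁻ (stableIntegrand α 0 l) = fun x : ℝ => (Real.exp (-(l * x)) : ℂ) *
    stableInversion α x := funext (fourierInv_stableIntegrand hα0 hα1 hl)
  have hinteg := integrable_exp_mul_stableInversion hα0 hα1 hl
  rw [← e] at hinteg
  have hF : Integrable (𝓕 (stableIntegrand α 0 l)) := by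
    refine hinteg.comp_neg.congr (Filter.Eventually.of_forall fun x => ?_)
    simp only [Real.fourierInv_eq_fourier_neg, neg_neg]
  have h := congrFun ((continuous_stableIntegrand α 0 hl).fourier_fourierInv_eq
    (integrable_stableIntegrand hα0 hα1 0 hl) hF) 0
  rw [Real.fourier_eq', e] at h
  simp only [inner_zero_right, mul_zero, Complex.ofReal_zero, zero_mul, Complex.exp_zero,
    one_smul] at h
  rw [h]
  simp [stableIntegrand, linePoint, Complex.ofReal_cpow hl.le]

theorem exists_stable_density {α : ℝ} (hα0 : 0 < α) (hα1 : α < 1) :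
    ∃ f : ℝ → ℝ, ContinuousOn f (Ioi 0) ∧ (∀ x, 0 < x → 0 ≤ f x) ∧
      (∀ l : ℝ, 0 < l → IntegrableOn (fun x => f x * Real.exp (-(l * x))) (Ioi 0)) ∧
      ∀ l : ℝ, 0 < l → ∫ x in Ioi (0 : ℝ), f x * Real.exp (-(l * x)) = Real.exp (-(l ^ α)) := by
  have hre : ∀ l x : ℝ, ((Real.exp (-(l * x)) : ℂ) * stableInversion α x).re =
      (stableInversion α x).re * Real.exp (-(l * x)) := fun l x => by
    rw [Complex.re_ofReal_mul, mul_comm]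
  have hinteg : ∀ l : ℝ, 0 < l →
      Integrable (fun x => (stableInversion α x).re * Real.exp (-(l * x))) := fun l hl => by
    exact (integrable_exp_mul_stableInversion hα0 hα1 hl).re.congr
      (Filter.Eventually.of_forall fun x => hre l x)
  have hlap : ∀ l : ℝ, 0 < l → ∫ x in Ioi (0 : ℝ),
      (stableInversion α x).re * Real.exp (-(l * x)) = Real.exp (-(l ^ α)) := fun l hl => by
    rw [← integral_Ici_eq_integral_Ioi, setIntegral_eq_integral_of_forall_compl_eq_zero
      fun x hx => by rw [stableInversion_of_neg hα0 hα1 (not_le.1 hx)]; simp]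
    have h := congrArg Complex.re (integral_exp_mul_stableInversion hα0 hα1 hl)
    rw [Complex.ofReal_re] at h
    rw [← h]
    simp only [← hre]
    exact integral_re (integrable_exp_mul_stableInversion hα0 hα1 hl)
  have hcont : ContinuousOn (fun x => (stableInversion α x).re) (Ioi 0) :=
    (Complex.continuous_re.comp (continuous_stableInversion hα0 hα1)).continuousOn
  refine ⟨fun x => (stableInversion α x).re, hcont, fun x hx => ?_,
    fun l hl => (hinteg l hl).integrableOn, hlap⟩
  exact nonneg_of_laplace_eq_exp_neg_rpow hα0.le hα1.le zero_le_one
    (fun l hl => (hinteg l hl).integrableOn) hcont (fun l hl => by rw [hlap l hl, one_mul]) hx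

theorem exists_isPositiveStableKernel {α : ℝ} (hα0 : 0 < α) (hα1 : α < 1) :
    ∃ p : ℝ → ℝ → ℝ, IsPositiveStableKernel α p := by
  obtain ⟨f, hc, hnn, hinteg, hlap⟩ := exists_stable_density hα0 hα1
  have hs : ∀ t : ℝ, 0 < t → 0 < t ^ (-(1 / α)) := fun t ht => Real.rpow_pos_of_pos ht _
  have he : ∀ c : ℝ, 0 < c → ∀ l : ℝ, (fun x => c * f (c * x) * Real.exp (-(l * x))) =
      fun x => c * (fun y => f y * Real.exp (-(l / c * y))) (c * x) := fun c hcp l => by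
    funext x
    simp only
    rw [show l / c * (c * x) = l * x by field_simp, mul_assoc]
  -- Self-similarity: replacing `l` by `l * t ^ (1 / α)` multiplies `l ^ α` by `t`.
  refine ⟨fun t x => t ^ (-(1 / α)) * f (t ^ (-(1 / α)) * x), ?_, ?_, ?_, ?_⟩
  · intro t ht
    refine continuousOn_const.mul (hc.comp (by fun_prop) fun x hx => mul_pos (hs t ht) hx)
  · intro t ht x hx
    exact mul_nonneg (hs t ht).le (hnn _ (mul_pos (hs t ht) hx))
  · intro t ht l hl
    rw [he _ (hs t ht)]
    refine Integrable.const_mul ?_ _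
    have := (integrableOn_Ioi_comp_mul_left_iff
      (fun y => f y * Real.exp (-(l / t ^ (-(1 / α)) * y))) 0 (hs t ht)).2
      (by rw [mul_zero]; exact hinteg _ (div_pos hl (hs t ht)))
    exact this
  · intro t ht l hl
    rw [he _ (hs t ht), integral_const_mul, integral_comp_mul_left_Ioi
      (fun y => f y * Real.exp (-(l / t ^ (-(1 / α)) * y))) 0 (hs t ht), mul_zero,
      hlap _ (div_pos hl (hs t ht)), smul_eq_mul, mul_inv_cancel_left₀ (hs t ht).ne',
      Real.div_rpow hl.le (hs t ht).le, ← Real.rpow_mul ht.le,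
      show -(1 / α) * α = -1 by field_simp, Real.rpow_neg_one, div_inv_eq_mul, mul_comm]

/-! ### Necessity -/

/-- The sign of the leading coefficient of `det [ψ (ε uᵢ vⱼ)]` as `ε → 0`. -/
theorem prod_coeff_mul_vandermonde_nonneg {k : ℕ} {ψ : ℝ → ℝ} {d : Fin (k + 1) → ℝ} {C : ℝ}
    (hψ : ∀ w, 0 ≤ w → w ≤ 1 → |ψ w - ∑ j, d j * w ^ (j : ℕ)| ≤ C * w ^ (k + 1))
    {u v : Fin (k + 1) → ℝ} (hu : Function.Injective u) (hv : Function.Injective v)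
    (hu0 : ∀ i, 0 ≤ u i) (hv0 : ∀ i, 0 ≤ v i)
    (hdet : ∀ ε : ℝ, 0 < ε → 0 ≤ (Matrix.of fun i j => ψ (ε * u i * v j)).det) :
    0 ≤ (∏ j, d j) * ((Matrix.vandermonde u).det * (Matrix.vandermonde v).det) := by
  set V := Matrix.vandermonde u with hV
  set W := (Matrix.vandermonde v).transpose with hW
  have hVd : IsUnit V.det := (Matrix.det_vandermonde_ne_zero_iff.2 hu).isUnit
  have hWd : IsUnit W.det := by
    rw [hW, Matrix.det_transpose]
    exact (Matrix.det_vandermonde_ne_zero_iff.2 hv).isUnit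
  let R : ℝ → Matrix (Fin (k + 1)) (Fin (k + 1)) ℝ := fun ε =>
    Matrix.of fun i j => (ε ^ k)⁻¹ *
      (ψ (ε * u i * v j) - ∑ l, d l * (ε * u i * v j) ^ (l : ℕ))
  -- Chosen so that the matrix is `V * diag (ε ^ l) * N ε * W` with `N ε → diag d`. The Taylor
  -- remainder is `O(ε ^ (k + 1))`, so it stays negligible after removing even the largest power `ε
  -- ^ k`.
  let N : ℝ → Matrix (Fin (k + 1)) (Fin (k + 1)) ℝ := fun ε =>
    Matrix.diagonal d + Matrix.diagonal (fun l : Fin (k + 1) => ε ^ (k - (l : ℕ))) *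
      (V⁻¹ * R ε * W⁻¹)
  have hR : Filter.Tendsto R (nhdsWithin 0 (Ioi 0)) (nhds 0) := by
    refine tendsto_pi_nhds.2 fun i => tendsto_pi_nhds.2 fun j => ?_
    have hb : Filter.Tendsto (fun ε : ℝ => C * (u i * v j) ^ (k + 1) * ε) (nhdsWithin 0 (Ioi 0))
        (nhds 0) := by
      refine Filter.Tendsto.mono_left ?_ nhdsWithin_le_nhds
      exact (by fun_prop : Continuous fun ε : ℝ => C * (u i * v j) ^ (k + 1) * ε).tendsto' _ _
        (by simp)
    have hsmall : ∀ᶠ ε : ℝ in nhdsWithin 0 (Ioi 0), ε * u i * v j < 1 := by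
      refine nhdsWithin_le_nhds ?_
      exact (by fun_prop : Continuous fun ε : ℝ => ε * u i * v j).continuousAt.eventually
        (gt_mem_nhds (by simp))
    refine squeeze_zero_norm' ?_ hb
    filter_upwards [hsmall, self_mem_nhdsWithin] with ε h1 hε
    have hε : 0 < ε := hε
    have h0 : 0 ≤ ε * u i * v j := mul_nonneg (mul_nonneg hε.le (hu0 i)) (hv0 j)
    have h := hψ _ h0 h1.le
    simp only [R, Matrix.of_apply, norm_mul, norm_inv, norm_pow, Real.norm_eq_abs, abs_of_pos hε]
    calc (ε ^ k)⁻¹ * _ ≤ (ε ^ k)⁻¹ * (C * (ε * u i * v j) ^ (k + 1)) := by gcongr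
      _ = C * (u i * v j) ^ (k + 1) * ε := by
        rw [mul_assoc ε, mul_pow ε, pow_succ ε]
        field_simp
  have hN : Filter.Tendsto N (nhdsWithin 0 (Ioi 0)) (nhds (Matrix.diagonal d)) := by
    have hD : Filter.Tendsto (fun ε : ℝ => Matrix.diagonal
        (fun l : Fin (k + 1) => ε ^ (k - (l : ℕ)))) (nhdsWithin 0 (Ioi 0))
        (nhds (Matrix.diagonal (fun l : Fin (k + 1) => (0 : ℝ) ^ (k - (l : ℕ))))) := by
      refine Filter.Tendsto.mono_left ?_ nhdsWithin_le_nhds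
      exact (Continuous.matrix_diagonal (by fun_prop)).tendsto 0
    have h := (hD.mul ((hR.const_mul V⁻¹).mul_const W⁻¹)).const_add (Matrix.diagonal d)
    simpa using h
  have hfac : ∀ ε : ℝ, 0 < ε → (Matrix.of fun i j => ψ (ε * u i * v j)) =
      V * (Matrix.diagonal (fun l : Fin (k + 1) => ε ^ (l : ℕ)) * N ε) * W := by
    intro ε hε
    have e1 : Matrix.diagonal (fun l : Fin (k + 1) => ε ^ (l : ℕ)) * N ε =
        Matrix.diagonal (fun l : Fin (k + 1) => ε ^ (l : ℕ) * d l) +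
          V⁻¹ * (ε ^ k • R ε) * W⁻¹ := by
      simp only [N]
      rw [mul_add, Matrix.diagonal_mul_diagonal, ← mul_assoc, Matrix.diagonal_mul_diagonal]
      have : (fun l : Fin (k + 1) => ε ^ (l : ℕ) * ε ^ (k - (l : ℕ))) = fun _ => ε ^ k := by
        funext l
        rw [← pow_add, Nat.add_sub_cancel' (Nat.lt_succ_iff.1 l.2)]
      rw [this]
      simp [← Matrix.smul_eq_diagonal_mul]
    rw [e1, mul_add, add_mul, show V * (V⁻¹ * (ε ^ k • R ε) * W⁻¹) * W =
      (V * V⁻¹) * (ε ^ k • R ε) * (W⁻¹ * W) by simp only [mul_assoc],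
      Matrix.mul_nonsing_inv _ hVd, Matrix.nonsing_inv_mul _ hWd, one_mul, mul_one]
    ext i j
    have e2 : (V * Matrix.diagonal (fun l : Fin (k + 1) => ε ^ (l : ℕ) * d l) * W) i j =
        ∑ l, d l * (ε * u i * v j) ^ (l : ℕ) := by
      rw [Matrix.mul_apply]
      refine Finset.sum_congr rfl fun l _ => ?_
      rw [Matrix.mul_diagonal, hV, hW, Matrix.transpose_apply, Matrix.vandermonde_apply,
        Matrix.vandermonde_apply]
      ring
    rw [Matrix.add_apply, e2]
    simp only [R, Matrix.of_apply, Matrix.smul_apply, smul_eq_mul]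
    field_simp
    ring
  have hlim : Filter.Tendsto (fun ε => (N ε).det * (V.det * W.det)) (nhdsWithin 0 (Ioi 0))
      (nhds ((Matrix.diagonal d).det * (V.det * W.det))) :=
    (((continuous_id.matrix_det).tendsto _).comp hN).mul_const _
  rw [Matrix.det_diagonal, hW, Matrix.det_transpose] at hlim
  refine ge_of_tendsto hlim ?_
  filter_upwards [self_mem_nhdsWithin] with ε hε
  have hε : 0 < ε := hε
  have h := hdet ε hε
  rw [hfac ε hε, Matrix.det_mul, Matrix.det_mul, Matrix.det_mul, Matrix.det_diagonal, hW,
    Matrix.det_transpose] at h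
  have hpos : 0 < ∏ l : Fin (k + 1), ε ^ (l : ℕ) := Finset.prod_pos fun _ _ => by positivity
  refine nonneg_of_mul_nonneg_right (b := (N ε).det * _) ?_ hpos
  calc 0 ≤ _ := h
    _ = _ := by ring

theorem sum_coeff_exp_neg_mul_linear (a b w : ℝ) (k : ℕ) :
    ∑ j ∈ Finset.range (k + 1), (-1) ^ j / (j.factorial : ℝ) * (b - a * j) * w ^ j =
      (b + a * w) * ∑ j ∈ Finset.range (k + 1), (-w) ^ j / (j.factorial : ℝ) -
        a * w * ((-w) ^ k / (k.factorial : ℝ)) := by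
  induction k with
  | zero => simp
  | succ k ih =>
    rw [Finset.sum_range_succ, ih, Finset.sum_range_succ _ (k + 1), Nat.factorial_succ,
      neg_pow w (k + 1), neg_pow w k]
    push_cast
    field_simp
    ring

theorem exp_neg_mul_linear_bound (a b : ℝ) (k : ℕ) :
    ∃ C, ∀ w, 0 ≤ w → w ≤ 1 → |Real.exp (-w) * (b + a * w) -
      ∑ j : Fin (k + 1), (-1) ^ (j : ℕ) / ((j : ℕ).factorial : ℝ) * (b - a * (j : ℕ)) *
        w ^ (j : ℕ)| ≤ C * w ^ (k + 1) := by
  set c : ℝ := ((k + 1).succ : ℝ) / ((k + 1).factorial * ((k + 1 : ℕ) : ℝ)) with hc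
  refine ⟨(|b| + |a|) * c + |a|, fun w h0 h1 => ?_⟩
  rw [Fin.sum_univ_eq_sum_range
    (fun j => (-1) ^ j / (j.factorial : ℝ) * (b - a * j) * w ^ j) (k + 1),
    sum_coeff_exp_neg_mul_linear]
  have hb := Real.exp_bound (x := -w) (by rwa [abs_neg, abs_of_nonneg h0]) (Nat.succ_pos k)
  rw [abs_neg, abs_of_nonneg h0] at hb
  set S := ∑ j ∈ Finset.range (k + 1), (-w) ^ j / (j.factorial : ℝ)
  have e : Real.exp (-w) * (b + a * w) - ((b + a * w) * S -
      a * w * ((-w) ^ k / (k.factorial : ℝ))) =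
      (b + a * w) * (Real.exp (-w) - S) + a * w * ((-w) ^ k / (k.factorial : ℝ)) := by ring
  rw [e]
  have h2 : |b + a * w| ≤ |b| + |a| := by
    refine (abs_add_le _ _).trans ?_
    rw [abs_mul, abs_of_nonneg h0]
    nlinarith [abs_nonneg a]
  have h3 : |(-w) ^ k / (k.factorial : ℝ)| ≤ w ^ k := by
    rw [abs_div, abs_pow, abs_neg, abs_of_nonneg h0, Nat.abs_cast]
    exact div_le_self (by positivity) (by exact_mod_cast Nat.succ_le_of_lt k.factorial_pos)
  calc _ ≤ |(b + a * w) * (Real.exp (-w) - S)| + |a * w * ((-w) ^ k / (k.factorial : ℝ))| :=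
        abs_add_le _ _
    _ = |b + a * w| * |Real.exp (-w) - S| + |a| * w * |(-w) ^ k / (k.factorial : ℝ)| := by
        rw [abs_mul, abs_mul, abs_mul, abs_of_nonneg h0]
    _ ≤ (|b| + |a|) * (w ^ (k + 1) * c) + |a| * w * w ^ k := by gcongr
    _ = _ := by ring

theorem integrable_stableKernel_mul {α : ℝ} {p : ℝ → ℝ → ℝ} (hp : IsPositiveStableKernel α p)
    {t l : ℝ} (ht : 0 < t) (hl : 0 < l) :
    IntegrableOn (fun x => p t x * (x ^ 2 * Real.exp (-(x * l)))) (Ioi 0) := by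
  refine (integrableOn_pow_mul_of_laplace (hp.integrableOn t ht) 2 hl).congr
    (Filter.Eventually.of_forall fun x => ?_)
  simp only [mul_comm x l]
  ring

/-- Moments of order 0 and 1 reduce, up to row and column factors, to the exponential kernel and
give no constraint on `α`; order 2 is the first to do so. -/
theorem det_stableMoment_two_nonneg {α : ℝ} {p : ℝ → ℝ → ℝ} (hp : IsPositiveStableKernel α p)
    {n m : ℕ} (hTP : IsTotallyPositive n (Ioi 0) p) (hm1 : 1 ≤ m) (hmn : m ≤ n)
    {t l : Fin m → ℝ} (ht : StrictMono t) (hl : StrictAnti l) (ht0 : ∀ i, 0 < t i)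
    (hl0 : ∀ j, 0 < l j) : 0 ≤ (Matrix.of fun i j => stableMoment α 2 (t i) (l j)).det := by
  have hA : (Matrix.of fun i j => stableMoment α 2 (t i) (l j)) =
      Matrix.of fun i j => ∫ x in Ioi (0 : ℝ), p (t i) x * (x ^ 2 * Real.exp (-(x * l j))) := by
    ext i j
    simp only [Matrix.of_apply]
    rw [← laplace_moment_eq_stableMoment (hp.integrableOn _ (ht0 i)) (hp.laplace _ (ht0 i)) 2 _
      (hl0 j)]
    congr 1
    funext x
    rw [mul_comm x (l j)]
    ring
  rw [hA]
  refine det_integral_mul_nonneg (volume.restrict (Ioi (0 : ℝ))) (I := Ioi 0)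
    (ae_restrict_mem measurableSet_Ioi) (K := fun i x => p (t i) x)
    (L := fun x j => x ^ 2 * Real.exp (-(x * l j)))
    (fun i j => integrable_stableKernel_mul hp (ht0 i) (hl0 j))
    (fun s hs hs0 => hTP m hm1 hmn t s ht hs ht0 hs0) fun s hs hs0 => ?_
  have h := Matrix.det_mul_column (fun i => s i ^ 2) (Matrix.of fun i j => Real.exp (-(s i * l j)))
  simp only [Matrix.of_apply] at h
  rw [h]
  exact mul_nonneg (Finset.prod_nonneg fun i _ => by positivity) (det_exp_neg_mul_nonneg hs hl hl0)

theorem not_isTotallyPositive_of_lt {α : ℝ} (hα0 : 0 < α) {p : ℝ → ℝ → ℝ}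
    (hp : IsPositiveStableKernel α p) {n k : ℕ} (hkn : k + 1 ≤ n) (hk : k * α < 1)
    (hk1 : 1 < (k + 1) * α) : ¬ IsTotallyPositive n (Ioi 0) p := by
  intro hTP
  set u : Fin (k + 1) → ℝ := fun i => (i : ℕ) + 1 with hu
  set v : Fin (k + 1) → ℝ := fun j => (k : ℝ) + 1 - (j : ℕ) with hv
  have hum : StrictMono u := fun i j hij => by
    have : ((i : ℕ) : ℝ) < (j : ℕ) := by exact_mod_cast hij
    simp only [hu]; linarith
  have hva : StrictAnti v := fun i j hij => by
    have : ((i : ℕ) : ℝ) < (j : ℕ) := by exact_mod_cast hij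
    simp only [hv]; linarith
  have hu0 : ∀ i, 0 < u i := fun i => by simp only [hu]; positivity
  have hv0 : ∀ j, 0 < v j := fun j => by
    have : ((j : ℕ) : ℝ) < (k + 1 : ℕ) := by exact_mod_cast j.2
    push_cast at this
    simp only [hv]; linarith
  -- The pure exponential serves as a reference: it fixes the sign of the factorials and Vandermonde
  -- determinants common to both expansions, so that these need not be computed.
  have hdetexp : ∀ ε : ℝ, 0 < ε →
      0 ≤ (Matrix.of fun i j => Real.exp (-(ε * u i * v j)) * (1 + 0 * (ε * u i * v j))).det := by
    intro ε hε
    simp only [zero_mul, add_zero, mul_one]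
    exact det_exp_neg_mul_nonneg (s := fun i => ε * u i)
      (fun i j hij => mul_lt_mul_of_pos_left (hum hij) hε) hva hv0
  have hdetst : ∀ ε : ℝ, 0 < ε → 0 ≤ (Matrix.of fun i j =>
      Real.exp (-(ε * u i * v j)) * ((1 - α) + α * (ε * u i * v j))).det := by
    intro ε hε
    have hpow : ∀ j, (v j ^ (1 / α)) ^ α = v j := fun j => by
      rw [← Real.rpow_mul (hv0 j).le, one_div_mul_cancel hα0.ne', Real.rpow_one]
    have h := det_stableMoment_two_nonneg hp hTP (Nat.succ_pos k) hkn
      -- With this `l`, the variable `t * l ^ α` becomes `ε * u i * v j`.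
      (t := fun i => ε * u i) (l := fun j => v j ^ (1 / α))
      (fun i j hij => mul_lt_mul_of_pos_left (hum hij) hε)
      (fun i j hij => Real.rpow_lt_rpow (hv0 j).le (hva hij) (by positivity))
      (fun i => mul_pos hε (hu0 i)) (fun j => Real.rpow_pos_of_pos (hv0 j) _)
    have hA : (Matrix.of fun i j => stableMoment α 2 (ε * u i) (v j ^ (1 / α))) =
        Matrix.of fun i j => (α * (ε * u i)) * (Matrix.of fun i j =>
          (((v j ^ (1 / α)) ^ 2)⁻¹ * v j) * (Matrix.of fun i j =>
          Real.exp (-(ε * u i * v j)) * ((1 - α) + α * (ε * u i * v j))) i j) i j := by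
      ext i j
      simp only [Matrix.of_apply]
      rw [stableMoment_two, hpow]
      ring
    rw [hA, Matrix.det_mul_column, Matrix.det_mul_row, ← mul_assoc] at h
    refine nonneg_of_mul_nonneg_right h (mul_pos (Finset.prod_pos fun i _ => ?_)
      (Finset.prod_pos fun j _ => ?_))
    · have := hu0 i; positivity
    · have := hv0 j
      have := Real.rpow_pos_of_pos this (1 / α)
      positivity
  obtain ⟨C₁, hC₁⟩ := exp_neg_mul_linear_bound 0 1 k
  obtain ⟨C₂, hC₂⟩ := exp_neg_mul_linear_bound α (1 - α) k
  have h1 := prod_coeff_mul_vandermonde_nonneg hC₁ hum.injective hva.injective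
    (fun i => (hu0 i).le) (fun j => (hv0 j).le) hdetexp
  have h2 := prod_coeff_mul_vandermonde_nonneg hC₂ hum.injective hva.injective
    (fun i => (hu0 i).le) (fun j => (hv0 j).le) hdetst
  rw [Finset.prod_mul_distrib] at h1 h2
  have hne : (∏ j : Fin (k + 1), (-1 : ℝ) ^ (j : ℕ) / ((j : ℕ).factorial : ℝ)) *
      ((Matrix.vandermonde u).det * (Matrix.vandermonde v).det) ≠ 0 := by
    refine mul_ne_zero (Finset.prod_ne_zero_iff.2 fun j _ => ?_) (mul_ne_zero
      (Matrix.det_vandermonde_ne_zero_iff.2 hum.injective)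
      (Matrix.det_vandermonde_ne_zero_iff.2 hva.injective))
    exact div_ne_zero (pow_ne_zero _ (by norm_num)) (by exact_mod_cast (j : ℕ).factorial_ne_zero)
  simp only [zero_mul, sub_zero, Finset.prod_const_one, mul_one] at h1
  have hpos := lt_of_le_of_ne h1 hne.symm
  have h3 : 0 ≤ ∏ j : Fin (k + 1), (1 - α - α * ((j : ℕ) : ℝ)) := by
    refine nonneg_of_mul_nonneg_right ?_ hpos
    calc 0 ≤ _ := h2
      _ = _ := by ring
  -- The first `k` factors are positive by `k * α < 1`, while the last, `1 - (k + 1) * α`, is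
  -- negative.
  rw [Fin.prod_univ_castSucc] at h3
  have h4 : 0 < ∏ j : Fin k, (1 - α - α * ((j.castSucc : ℕ) : ℝ)) := by
    refine Finset.prod_pos fun j _ => ?_
    have : ((j : ℕ) : ℝ) + 1 ≤ k := by exact_mod_cast j.2
    simp only [Fin.val_castSucc]
    nlinarith
  have h5 := nonneg_of_mul_nonneg_right h3 h4
  simp only [Fin.val_last] at h5
  linarith

/-! ### The characterization -/

theorem theorem1 (α : ℝ) (hα0 : 0 < α) (hα1 : α < 1) :
    (∃ p : ℝ → ℝ → ℝ, IsPositiveStableKernel α p) ∧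
    ∀ p : ℝ → ℝ → ℝ, IsPositiveStableKernel α p →
      ∀ n : ℕ, 2 ≤ n →
        (IsTotallyPositive n (Ioi 0) p ↔
          (∃ k : ℕ, 2 ≤ k ∧ k ≤ n ∧ α = 1 / (k : ℝ)) ∨ α < 1 / (n : ℝ)) := by
  refine ⟨exists_isPositiveStableKernel hα0 hα1, fun p hp n hn => ⟨fun hTP => ?_, fun h => ?_⟩⟩
  · by_contra! hcon
    obtain ⟨hne, hge⟩ := hcon
    have hn0 : (0 : ℝ) < n := by exact_mod_cast (by omega : 0 < n)
    have hlt : 1 / α < n := by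
      have h1 : 1 / (n : ℝ) < α := lt_of_le_of_ne hge (hne n hn le_rfl).symm
      rw [div_lt_iff₀ hn0] at h1
      rw [div_lt_iff₀ hα0]
      linarith
    have hfl : (⌊1 / α⌋₊ : ℝ) ≤ 1 / α := Nat.floor_le (by positivity)
    have hfn : ⌊1 / α⌋₊ < n := by exact_mod_cast hfl.trans_lt hlt
    have hinv : 1 < 1 / α := by rwa [lt_div_iff₀ hα0, one_mul]
    have hfl1 : 1 ≤ ⌊1 / α⌋₊ := Nat.le_floor (by exact_mod_cast hinv.le)
    -- Equality would make `α` the reciprocal of an integer between `2` and `n`, which is excluded;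
    -- hence `k = ⌊1 / α⌋₊` satisfies both strict inequalities of the obstruction.
    have hstrict : (⌊1 / α⌋₊ : ℝ) < 1 / α := by
      refine lt_of_le_of_ne hfl fun heq => ?_
      refine hne ⌊1 / α⌋₊ ?_ hfn.le (by rw [heq, one_div_one_div])
      have : (1 : ℝ) < ⌊1 / α⌋₊ := by rw [heq]; exact hinv
      exact_mod_cast this
    refine not_isTotallyPositive_of_lt hα0 hp (k := ⌊1 / α⌋₊) hfn ?_ ?_ hTP
    · rwa [lt_div_iff₀ hα0] at hstrict
    · rw [← div_lt_iff₀ hα0]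
      exact Nat.lt_floor_add_one _
  · intro m hm1 hmn t x ht hx ht0 hx0
    rcases h with ⟨k, hk2, -, rfl⟩ | h
    · have hk : (2 : ℝ) ≤ k := by exact_mod_cast hk2
      refine det_stableKernel_nonneg hα0 hp (by rw [one_div_one_div]; linarith)
        (Or.inl ⟨k - 2, ?_⟩) ht hx ht0 hx0
      rw [one_div_one_div, Nat.cast_sub hk2, Nat.cast_ofNat]
    · have hn2 : (2 : ℝ) ≤ n := by exact_mod_cast hn
      have hlt : (n : ℝ) < 1 / α := by
        rw [lt_div_iff₀ (by linarith)] at h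
        rw [lt_div_iff₀ hα0]
        linarith
      have hmn' : (m : ℝ) ≤ n := by exact_mod_cast hmn
      exact det_stableKernel_nonneg hα0 hp (by linarith) (Or.inr (by linarith)) ht hx ht0 hx0
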